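/- Let $q\ge 5$ be odd and $0<\epsilon\le 1/2$. Let $W$ be the typewriter channel on $\mathbb{Z}_q$: $W(y|x)=1-\epsilon$ if $y=x$, $W(y|x)=\epsilon$ if $y=x+1 \bmod q$, and $W(y|x)=0$ otherwise. All logarithms are to base 2. Let $$E(R)=\limsup_{n\to\infty}\frac1n\log\frac{1}{\mathsf P_e(\lceil 2^{nR}\rceil,n)}\in[0,\infty]$$ be its reliability function, where $\mathsf P_e(M,n)$ is the smallest average probability of error of codes with $M$ codewords of length $n$ over the memoryless channel $W$, and let $$E_{\mathrm{sp}}(R)=\sup_{\rho\ge 0}\bigl(E_0(\rho)-\rho R\bigr),\qquad E_0(\rho)=\max_P\Bigl[-\log\sum_y\Bigl(\sum_x P(x)W(y|x)^{1/(1+\rho)}\Bigr)^{1+\rho}\Bigr]$$ be its sphere-packing exponent (possibly $\infty$), where $P$ ranges over the probability distributions on $\mathbb{Z}_q$. Let $\theta(C_q)$ be the Lovász theta function of the cycle $C_q$ of length $q$. Then there is exactly one rate $R_1>\log\theta(C_q)$ with $E_{\mathrm{sp}}(R_1)<\infty$ such that the line $\ell$ through $(\log\theta(C_q),\log\frac1\epsilon)$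 and $(R_1,E_{\mathrm{sp}}(R_1))$ is tangent to the sphere-packing curve at $R_1$, in the sense that $\ell(R)\le E_{\mathrm{sp}}(R)$ for all real $R$. If $\epsilon<1/2$, then moreover $E_{\mathrm{sp}}$ is differentiable at $R_1$ and its derivative there is the slope of $\ell$. The segment of $\ell$ between these two points is an upper bound on the reliability function: $$E(R)\le \ell(R)\qquad\text{for } \log\theta(C_q)<R\le R_1 .$$ -/

import Mathlib

open Filter

noncomputable section

/-! ### Discrete memoryless channels and the reliability function -/

/-- The typewriter channel on `ZMod q`: `typewriter q ε x y` is the probability `W(y|x)`. -/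
def typewriter (q : ℕ) (ε : ℝ) (x y : ZMod q) : ℝ :=
  if y = x then 1 - ε else if y = x + 1 then ε else 0

section Channel

variable {X Y : Type*} [Fintype X] [Fintype Y]

/-- Average error probability, over the memoryless channel `W`, of the block code of length `n`
with codewords `enc m`, `m : Fin M`, and decoder `dec`. -/
def avgErrorProb (W : X → Y → ℝ) {M n : ℕ} (enc : Fin M → Fin n → X)
    (dec : (Fin n → Y) → Fin M) : ℝ :=
  (1 / (M : ℝ)) * ∑ m : Fin M, ∑ y : Fin n → Y,
    if dec y = m then 0 else ∏ i : Fin n, W (enc m i) (y i)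

/-- The smallest average error probability of codes with `M` codewords of length `n`. -/
def minErrorProb (W : X → Y → ℝ) (M n : ℕ) : ℝ :=
  ⨅ c : (Fin M → Fin n → X) × ((Fin n → Y) → Fin M), avgErrorProb W c.1 c.2

/-- The reliability function (in bits), with values in `[-∞, ∞]`; the exponent is `∞` at
blocklengths where the error probability is `0`. -/
def reliability (W : X → Y → ℝ) (R : ℝ) : EReal :=
  limsup (fun n : ℕ =>
    if minErrorProb W ⌈(2 : ℝ) ^ ((n : ℝ) * R)⌉₊ n = 0 then (⊤ : EReal)
    else (((1 / (n : ℝ)) *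
      Real.logb 2 (1 / minErrorProb W ⌈(2 : ℝ) ^ ((n : ℝ) * R)⌉₊ n) : ℝ) : EReal)) atTop

/-- Gallager's function `E₀(ρ)`, maximized over the input distributions `P`. -/
def gallagerE0 (W : X → Y → ℝ) (ρ : ℝ) : ℝ :=
  ⨆ P : stdSimplex ℝ X,
    -Real.logb 2 (∑ y : Y, (∑ x : X, P.1 x * W x y ^ (1 / (1 + ρ))) ^ (1 + ρ))

/-- The sphere-packing exponent `E_sp(R) = sup_{ρ ≥ 0} (E₀(ρ) - ρ R)`, possibly `∞`. -/
def spherePacking (W : X → Y → ℝ) (R : ℝ) : EReal :=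
  ⨆ ρ : {ρ : ℝ // 0 ≤ ρ}, ((gallagerE0 W ρ.1 - ρ.1 * R : ℝ) : EReal)

end Channel

/-! ### The Lovász theta function -/

/-- The Lovász theta function: the infimum of `max_i 1 / ⟪c, u i⟫ ^ 2` over the orthonormal
representations `u` of `G` (unit vectors, orthogonal for distinct nonadjacent vertices) and
the unit vectors `c`. -/
def lovaszTheta {V : Type*} (G : SimpleGraph V) : ℝ :=
  sInf {t : ℝ | ∃ (d : ℕ) (u : V → EuclideanSpace ℝ (Fin d)) (c : EuclideanSpace ℝ (Fin d)),
    (∀ i, ‖u i‖ = 1) ∧ (∀ i j, i ≠ j → ¬ G.Adj i j → inner ℝ (u i) (u j) = 0) ∧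
    ‖c‖ = 1 ∧ ∀ i, inner ℝ c (u i) ≠ 0 ∧ 1 / (inner ℝ c (u i)) ^ 2 ≤ t}

/-! ### Tangent segments -/

/-- Slope of the line through `(R₀, E₀)` and `(R₁, E₁)`. -/
def slopeThrough (R₀ E₀ R₁ E₁ : ℝ) : ℝ := (E₁ - E₀) / (R₁ - R₀)

/-- Height at `R` of the line through `(R₀, E₀)` and `(R₁, E₁)`. -/
def lineThrough (R₀ E₀ R₁ E₁ R : ℝ) : ℝ := E₀ + slopeThrough R₀ E₀ R₁ E₁ * (R - R₀)

/-- The segment from `(R₀, E₀)` rightwards to the point of the curve `E = F R` at `R₁` is tangent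
to that (convex) curve: the line through it touches the curve at `R₁` and nowhere lies above
it. -/
def IsTangentAt (F : ℝ → EReal) (R₀ E₀ R₁ : ℝ) : Prop :=
  R₀ < R₁ ∧ F R₁ ≠ ⊤ ∧ F R₁ ≠ ⊥ ∧
    ∀ R : ℝ, ((lineThrough R₀ E₀ R₁ (F R₁).toReal R : ℝ) : EReal) ≤ F R

end

/-! Cut a block of length n into n₁ + n₂ letters and fix the first n₁ outputs. Two messages whose
last n₂ letters are everywhere equal or adjacent share an output of probability at least ε ^ n₂, so
one of them errs at least that often. The messages with smaller conditional error therefore form a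
zero-error code for the cycle, and Lovász's bound leaves at most θ ^ n₂ of them. The first block
thus acts as a list decoder with lists of that size, and counting noise words of weight k against
the lists gives `avgErrorProb_typewriter_ge`. With n₂ ≈ μ n and k ≈ δ n₁, rates above μ log θ + (1 -
μ)(log q - h(δ)) have exponent at most μ log (1/ε) + (1 - μ) D(δ‖ε) (`eventually_exponent_le`). For
tilted δ, this traces the segment from (log θ, log (1/ε)) to a point of the sphere-packing curve.

Tangency is Legendre duality. The curve is the conjugate of E₀, so for ρ > 0 the line of slope -ρ
through (log θ, log (1/ε)) is tangent exactly when E₀(ρ) = log (1/ε) + ρ log θ. The slopes of E₀ are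
at least log (q/2) > log θ, so E₀(ρ) - ρ log θ rises strictly and without bound from 0, and exactly
one ρ works. The strict inequality θ < q/2 holds because the spectrum of an odd cycle stays away
from -2. -/

/-! ### Lovász's bound on zero-error codes -/

section Theta

variable {V : Type*}

/-- A set of words over `V` any two of which differ, at some position, in distinct nonadjacent
letters has at most `t ^ N` elements if `G` has an orthonormal representation of value `t`. -/
theorem card_le_pow_of_orthonormalRep {G : SimpleGraph V} {d : ℕ} {t : ℝ}
    {u : V → EuclideanSpace ℝ (Fin d)} {c : EuclideanSpace ℝ (Fin d)}
    (hu : ∀ i, ‖u i‖ = 1) (hG : ∀ i j, i ≠ j → ¬ G.Adj i j → inner ℝ (u i) (u j) = 0)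
    (hc : ‖c‖ = 1) (ht : ∀ i, inner ℝ c (u i) ≠ 0 ∧ 1 / (inner ℝ c (u i)) ^ 2 ≤ t) (ht0 : 0 < t)
    {ι : Type*} (S : Finset ι) {N : ℕ} (f : ι → Fin N → V)
    (hf : ∀ a ∈ S, ∀ b ∈ S, a ≠ b → ∃ i, f a i ≠ f b i ∧ ¬ G.Adj (f a i) (f b i)) :
    (S.card : ℝ) ≤ t ^ N := by
  classical
  -- The tensor product of the `v i`, in coordinates. Inner products multiply, so one orthogonal
  -- factor makes two code vectors orthogonal; Bessel's inequality against the tensor power of `c`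
  -- then counts them.
  let T : (Fin N → EuclideanSpace ℝ (Fin d)) → EuclideanSpace ℝ (Fin N → Fin d) :=
    fun v => WithLp.toLp 2 fun α => ∏ i, v i (α i)
  have hT : ∀ v w, inner ℝ (T v) (T w) = ∏ i, inner ℝ (v i) (w i) := by
    intro v w
    simp only [T, PiLp.inner_apply]
    rw [Finset.prod_univ_sum, Fintype.piFinset_univ]
    simp [Finset.prod_mul_distrib]
  have hself : ∀ x : EuclideanSpace ℝ (Fin d), ‖x‖ = 1 → inner ℝ x x = 1 := by
    intro x hx
    rw [real_inner_self_eq_norm_sq, hx]; norm_num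
  have hT1 : ∀ v, (∀ i, ‖v i‖ = 1) → ‖T v‖ = 1 := by
    intro v hv
    have : ‖T v‖ ^ 2 = 1 := by
      rw [← real_inner_self_eq_norm_sq, hT]
      exact Finset.prod_eq_one fun i _ => hself _ (hv i)
    nlinarith [norm_nonneg (T v)]
  have horth : Orthonormal ℝ (fun a : S => T fun i => u (f a i)) := by
    refine ⟨fun a => hT1 _ fun i => hu _, fun a b hab => ?_⟩
    change inner ℝ (T _) (T _) = 0
    rw [hT]
    obtain ⟨i, hi, hi'⟩ := hf a a.2 b b.2 (fun h => hab (Subtype.ext h))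
    exact Finset.prod_eq_zero (Finset.mem_univ i) (hG _ _ hi hi')
  have hB := horth.sum_inner_products_le (T fun _ => c) (s := Finset.univ)
  rw [hT1 _ fun _ => hc] at hB
  have hterm : ∀ a : S, (t ^ N)⁻¹ ≤ ‖inner ℝ (T fun i => u (f a i)) (T fun _ => c)‖ ^ 2 := by
    intro a
    rw [hT, Real.norm_eq_abs, sq_abs, ← Finset.prod_pow, ← inv_pow]
    calc t⁻¹ ^ N = ∏ _i : Fin N, t⁻¹ := by simp
      _ ≤ _ := by
        refine Finset.prod_le_prod (fun _ _ => by positivity) fun i _ => ?_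
        rw [real_inner_comm]
        have h := ht (f a i)
        have h0 : 0 < (inner ℝ c (u (f a i))) ^ 2 := by have := h.1; positivity
        rw [inv_le_comm₀ ht0 h0, ← one_div]
        exact h.2
  have h2 := (Finset.sum_le_sum fun a (_ : a ∈ Finset.univ) => hterm a).trans hB
  simp only [Finset.sum_const, Finset.card_univ, Fintype.card_coe, nsmul_eq_mul, one_pow] at h2
  have : 0 < t ^ N := by positivity
  rwa [← div_eq_mul_inv, div_le_one this] at h2

/-- The values of orthonormal representations, whose infimum is `lovaszTheta G`. -/
def orthonormalRepValues (G : SimpleGraph V) : Set ℝ :=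
  {t : ℝ | ∃ (d : ℕ) (u : V → EuclideanSpace ℝ (Fin d)) (c : EuclideanSpace ℝ (Fin d)),
    (∀ i, ‖u i‖ = 1) ∧ (∀ i j, i ≠ j → ¬ G.Adj i j → inner ℝ (u i) (u j) = 0) ∧
    ‖c‖ = 1 ∧ ∀ i, inner ℝ c (u i) ≠ 0 ∧ 1 / (inner ℝ c (u i)) ^ 2 ≤ t}

theorem one_le_of_mem_orthonormalRepValues [Nonempty V] {G : SimpleGraph V} {t : ℝ}
    (h : t ∈ orthonormalRepValues G) : 1 ≤ t := by
  obtain ⟨d, u, c, hu, -, hc, ht⟩ := h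
  obtain ⟨i⟩ := ‹Nonempty V›
  refine le_trans ?_ (ht i).2
  have h1 := abs_real_inner_le_norm c (u i)
  rw [hc, hu, one_mul] at h1
  have h0 : 0 < (inner ℝ c (u i)) ^ 2 := by have := (ht i).1; positivity
  rw [le_div_iff₀ h0, one_mul]
  exact (sq_le_one_iff_abs_le_one _).2 h1

theorem one_le_lovaszTheta [Nonempty V] {G : SimpleGraph V}
    (hne : (orthonormalRepValues G).Nonempty) : 1 ≤ lovaszTheta G :=
  le_csInf hne fun _ => one_le_of_mem_orthonormalRepValues

theorem lovaszTheta_le_of_mem [Nonempty V] {G : SimpleGraph V} {t : ℝ}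
    (h : t ∈ orthonormalRepValues G) : lovaszTheta G ≤ t :=
  csInf_le ⟨1, fun _ => one_le_of_mem_orthonormalRepValues⟩ h

/-- The infimum need not be attained, but the bound by `t ^ N` is a closed condition on `t` and so
passes to it. -/
theorem card_le_lovaszTheta_pow [Nonempty V] {G : SimpleGraph V}
    (hne : (orthonormalRepValues G).Nonempty)
    {ι : Type*} (S : Finset ι) {N : ℕ} (f : ι → Fin N → V)
    (hf : ∀ a ∈ S, ∀ b ∈ S, a ≠ b → ∃ i, f a i ≠ f b i ∧ ¬ G.Adj (f a i) (f b i)) :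
    (S.card : ℝ) ≤ lovaszTheta G ^ N := by
  have hall : ∀ t ∈ orthonormalRepValues G, (S.card : ℝ) ≤ t ^ N := by
    intro t ht
    have h1 := one_le_of_mem_orthonormalRepValues ht
    obtain ⟨d, u, c, hu, hG, hc, ht⟩ := ht
    exact card_le_pow_of_orthonormalRep hu hG hc ht (by linarith) S f hf
  have hcl : lovaszTheta G ∈ closure (orthonormalRepValues G) :=
    csInf_mem_closure hne ⟨1, fun _ => one_le_of_mem_orthonormalRepValues⟩
  have hclosed : IsClosed {t : ℝ | (S.card : ℝ) ≤ t ^ N} :=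
    isClosed_le continuous_const (continuous_pow N)
  exact closure_minimal hall hclosed hcl

end Theta

/-! ### Odd cycles: theta is below q/2 -/

section Cycle

/-- On an odd cycle, `x i` is half of an alternating sum of the `x j + x (j + 1)`. -/
theorem alternating_sum_cycle {q : ℕ} [NeZero q] (hq : Odd q) (x : ZMod q → ℝ) (i : ZMod q) :
    ∑ j ∈ Finset.range q, (-1 : ℝ) ^ j * (x (i + j) + x (i + j + 1)) = 2 * x i := by
  -- The sum telescopes; after an odd number `q` of steps it is back at `i` with sign -1.
  have h : ∀ m : ℕ, ∑ j ∈ Finset.range m, (-1 : ℝ) ^ j * (x (i + j) + x (i + j + 1))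
      = x i - (-1) ^ m * x (i + m) := by
    intro m
    induction m with
    | zero => simp
    | succ m ih =>
      rw [Finset.sum_range_succ, ih]
      push_cast
      rw [← add_assoc]
      ring
  rw [h, hq.neg_one_pow]
  simp
  ring

theorem sum_range_zmod {q : ℕ} [NeZero q] (g : ZMod q → ℝ) (i : ZMod q) :
    ∑ j ∈ Finset.range q, g (i + j) = ∑ j, g j := by
  rw [← Equiv.sum_comp (Equiv.addLeft i) g]
  refine Finset.sum_bij' (fun j _ => (j : ZMod q)) (fun j _ => j.val) ?_ ?_ ?_ ?_ ?_
  · simp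
  · intro a _; simpa using ZMod.val_lt a
  · intro a ha; exact ZMod.val_cast_of_lt (by simpa using ha)
  · intro a _; simp
  · intro a _; simp

/-- Cauchy–Schwarz on the alternating sum. The right-hand sum is the quadratic form of 2I + A, so
the least eigenvalue of A is at least -2 + 4/q². -/
theorem sum_sq_le_cycle {q : ℕ} [NeZero q] (hq : Odd q) (x : ZMod q → ℝ) :
    4 * ∑ i, x i ^ 2 ≤ (q : ℝ) ^ 2 * ∑ i, (x i + x (i + 1)) ^ 2 := by
  have h : ∀ i, 4 * x i ^ 2 ≤ q * ∑ j, (x j + x (j + 1)) ^ 2 := by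
    intro i
    have h1 := sq_sum_le_card_mul_sum_sq (s := Finset.range q)
      (f := fun j : ℕ => (-1 : ℝ) ^ j * (x (i + j) + x (i + j + 1)))
    rw [alternating_sum_cycle hq] at h1
    simp only [mul_pow, ← pow_mul, mul_comm _ 2, Finset.card_range] at h1
    simp only [pow_mul, neg_one_sq, one_pow, one_mul] at h1
    rw [sum_range_zmod (fun j => (x j + x (j + 1)) ^ 2)] at h1
    linarith
  have h2 := Finset.sum_le_sum fun i (_ : i ∈ Finset.univ) => h i
  rw [← Finset.mul_sum] at h2
  simp only [Finset.sum_const, Finset.card_univ, ZMod.card, nsmul_eq_mul] at h2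
  linarith

/-- The Gram matrix `I + y A`, `A` the adjacency matrix of the cycle. -/
def cycleGram (q : ℕ) (y : ℝ) : Matrix (ZMod q) (ZMod q) ℝ := fun i j =>
  (if j = i then 1 else 0) + y * ((if j = i + 1 then 1 else 0) + (if j = i - 1 then 1 else 0))

theorem cycleGram_symm (q : ℕ) (y : ℝ) (i j : ZMod q) : cycleGram q y i j = cycleGram q y j i := by
  have h1 : (j = i) ↔ (i = j) := eq_comm
  have h2 : (j = i + 1) ↔ (i = j - 1) := by rw [eq_sub_iff_add_eq, eq_comm]
  have h3 : (j = i - 1) ↔ (i = j + 1) := by rw [eq_sub_iff_add_eq, eq_comm]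
  unfold cycleGram
  simp only [h1, h2, h3]
  ring

theorem cycleGram_sum (q : ℕ) [NeZero q] (y : ℝ) (i : ZMod q) (x : ZMod q → ℝ) :
    ∑ j, cycleGram q y i j * x j = x i + y * (x (i + 1) + x (i - 1)) := by
  simp [cycleGram, add_mul, Finset.sum_add_distrib, mul_add]

theorem cycleGram_posSemidef {q : ℕ} [NeZero q] (hq : Odd q) {y : ℝ} (hy : 0 ≤ y)
    (hy' : 2 * y * (1 - 2 / (q : ℝ) ^ 2) ≤ 1) : (cycleGram q y).PosSemidef := by
  refine Matrix.PosSemidef.of_dotProduct_mulVec_nonneg ?_ fun x => ?_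
  · ext i j
    simpa using cycleGram_symm q y j i
  · have e1 : star x ⬝ᵥ (cycleGram q y).mulVec x
        = ∑ i, x i ^ 2 + y * (∑ i, x i * x (i + 1) + ∑ i, x i * x (i - 1)) := by
      simp only [dotProduct, Matrix.mulVec, cycleGram_sum, star_trivial, mul_add,
        Finset.sum_add_distrib, Finset.mul_sum]
      congr 1
      · exact Finset.sum_congr rfl fun i _ => by ring
      · congr 1 <;> exact Finset.sum_congr rfl fun i _ => by ring
    have e2 : ∑ i, x i * x (i - 1) = ∑ i, x i * x (i + 1) := by
      rw [← Equiv.sum_comp (Equiv.addRight (1 : ZMod q)) (fun i => x i * x (i - 1))]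
      exact Finset.sum_congr rfl fun i _ => by simp [mul_comm]
    have e3 : ∑ i, x (i + 1) ^ 2 = ∑ i, x i ^ 2 :=
      Equiv.sum_comp (Equiv.addRight (1 : ZMod q)) (fun i => x i ^ 2)
    have e4 : ∑ i, (x i + x (i + 1)) ^ 2 = 2 * ∑ i, x i ^ 2 + 2 * ∑ i, x i * x (i + 1) := by
      simp only [add_sq, Finset.sum_add_distrib, e3, mul_assoc, ← Finset.mul_sum]
      ring
    have h := sum_sq_le_cycle hq x
    rw [e1, e2]
    have hq0 : (0 : ℝ) < (q : ℝ) ^ 2 := by have := NeZero.pos q; positivity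
    have hA : 0 ≤ ∑ i, x i ^ 2 := Finset.sum_nonneg fun i _ => sq_nonneg _
    set A := ∑ i, x i ^ 2
    set C := ∑ i, x i * x (i + 1)
    rw [e4] at h
    have h' : 4 / (q : ℝ) ^ 2 * A ≤ 2 * A + 2 * C := by
      rw [div_mul_eq_mul_div, div_le_iff₀ hq0]; linarith
    have h3 := mul_le_mul_of_nonneg_left h' hy
    have h4 := mul_le_mul_of_nonneg_right hy' hA
    have : 2 * y * (1 - 2 / (q : ℝ) ^ 2) * A = 2 * y * A - y * (4 / (q : ℝ) ^ 2 * A) := by ring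
    linarith

theorem exists_gram_of_posSemidef {ι : Type*} [Fintype ι] {A : Matrix ι ι ℝ}
    (hA : A.PosSemidef) :
    ∃ u : ι → EuclideanSpace ℝ (Fin (Fintype.card ι)), ∀ i j, inner ℝ (u i) (u j) = A i j := by
  classical
  open scoped MatrixOrder in
  obtain ⟨B, rfl⟩ := CStarAlgebra.nonneg_iff_eq_star_mul_self.mp hA.nonneg
  refine ⟨fun i => WithLp.toLp 2 fun k => B ((Fintype.equivFin ι).symm k) i, fun i j => ?_⟩
  simp only [PiLp.inner_apply, Matrix.star_eq_conjTranspose, Matrix.mul_apply,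
    Matrix.conjTranspose_apply]
  rw [← Equiv.sum_comp (Fintype.equivFin ι).symm]
  exact Finset.sum_congr rfl fun k _ => by simp [mul_comm]

theorem cycleGraph_adj_finEquiv {q : ℕ} [NeZero q] (hq : 2 ≤ q) (x y : ZMod q) :
    (SimpleGraph.cycleGraph q).Adj ((ZMod.finEquiv q).symm x) ((ZMod.finEquiv q).symm y) ↔
      x = y + 1 ∨ y = x + 1 := by
  obtain ⟨n, rfl⟩ := Nat.exists_eq_add_of_le' hq
  rw [SimpleGraph.cycleGraph_adj]
  have key : ∀ a b : ZMod (n + 2), (ZMod.finEquiv (n + 2)).symm a - (ZMod.finEquiv (n + 2)).symm b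
      = 1 ↔ a = b + 1 := by
    intro a b
    rw [← map_sub, ← map_one (ZMod.finEquiv (n + 2)).symm, EmbeddingLike.apply_eq_iff_eq,
      sub_eq_iff_eq_add, add_comm 1 b]
  rw [key, key]

/-- Vectors with Gram matrix I + yA, and their normalized sum as handle, have value q / (1 + 2y). At
y = 1/2 this is q/2; the spectral gap of the odd cycle permits a larger y. -/
theorem exists_orthonormalRep_cycleGraph {q : ℕ} [NeZero q] (hq3 : 3 ≤ q) (hq : Odd q) :
    ∃ t ∈ orthonormalRepValues (SimpleGraph.cycleGraph q), t < q / 2 := by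
  have hq3' : (3 : ℝ) ≤ q := by exact_mod_cast hq3
  have hb : 0 < 1 - 2 / (q : ℝ) ^ 2 := by
    rw [sub_pos, div_lt_one (by positivity)]; nlinarith
  have hb1 : 1 - 2 / (q : ℝ) ^ 2 < 1 := by
    have : 0 < 2 / (q : ℝ) ^ 2 := by positivity
    linarith
  -- The largest `y` admitted by `cycleGram_posSemidef`.
  obtain ⟨y, hy⟩ : ∃ y : ℝ, y = 1 / (2 * (1 - 2 / (q : ℝ) ^ 2)) := ⟨_, rfl⟩
  have hy1 : 2 * y * (1 - 2 / (q : ℝ) ^ 2) = 1 := by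
    rw [hy, mul_one_div, mul_comm 2 (1 - _), div_mul_eq_mul_div, mul_comm 2, div_self (by positivity)]
  have hy2 : 1 / 2 < y := by
    rw [hy, div_lt_div_iff₀ (by norm_num) (by positivity)]; linarith
  have hps := cycleGram_posSemidef hq (by linarith : 0 ≤ y) hy1.le
  obtain ⟨u, hu⟩ := exists_gram_of_posSemidef hps
  have hz : (1 : ZMod q) ≠ 0 := by
    have : Fact (1 < q) := ⟨by omega⟩
    exact one_ne_zero
  have hdiag : ∀ i, cycleGram q y i i = 1 := by
    intro i
    have h1 : ¬ i = i + 1 := by simpa using hz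
    have h2 : ¬ i = i - 1 := by simpa [eq_sub_iff_add_eq] using hz
    simp [cycleGram, h1, h2]
  have hsum : ∀ i, ∑ j, cycleGram q y i j = 1 + 2 * y := by
    intro i
    have := cycleGram_sum q y i (fun _ => 1)
    simp only [mul_one] at this
    rw [this]; ring
  -- The squared norm of the sum of the `u j` is q(1 + 2y).
  obtain ⟨κ, hκ0, hκ⟩ : ∃ κ : ℝ, 0 < κ ∧ κ ^ 2 * (q * (1 + 2 * y)) = 1 := by
    have hp : 0 < q * (1 + 2 * y) := by positivity
    refine ⟨√(1 / (q * (1 + 2 * y))), by positivity, ?_⟩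
    rw [Real.sq_sqrt (by positivity)]
    field_simp
  have hcu : ∀ i, inner ℝ (κ • ∑ j, u j) (u i) = κ * (1 + 2 * y) := by
    intro i
    rw [real_inner_smul_left, sum_inner]
    simp only [hu, cycleGram_symm q y _ i, hsum]
  refine ⟨q / (1 + 2 * y), ⟨_, fun i => u (ZMod.finEquiv q i), κ • ∑ j, u j, fun i => ?_,
    fun i j hij hadj => ?_, ?_, fun i => ?_⟩, ?_⟩
  · have : ‖u (ZMod.finEquiv q i)‖ ^ 2 = 1 := by
      rw [← real_inner_self_eq_norm_sq, hu, hdiag]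
    nlinarith [norm_nonneg (u (ZMod.finEquiv q i))]
  · obtain ⟨a, rfl⟩ := (ZMod.finEquiv q).symm.surjective i
    obtain ⟨b, rfl⟩ := (ZMod.finEquiv q).symm.surjective j
    rw [cycleGraph_adj_finEquiv (by omega), not_or] at hadj
    have hab : ¬ b = a := fun h => hij (by rw [h])
    have h1 : ¬ b = a - 1 := fun h => hadj.1 (by rw [h]; ring)
    simp [hu, cycleGram, hab, hadj.2, h1]
  · have : ‖κ • ∑ j, u j‖ ^ 2 = 1 := by
      rw [← real_inner_self_eq_norm_sq, real_inner_smul_right, inner_sum]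
      simp only [hcu, Finset.sum_const, Finset.card_univ, ZMod.card, nsmul_eq_mul]
      linarith
    nlinarith [norm_nonneg (κ • ∑ j, u j)]
  · rw [hcu]
    refine ⟨by positivity, le_of_eq ?_⟩
    rw [div_eq_div_iff (by positivity) (by positivity)]
    linear_combination (-(1 + 2 * y)) * hκ
  · rw [div_lt_div_iff₀ (by positivity) (by norm_num)]
    nlinarith

end Cycle

/-! ### Error bound at finite length, and Gallager's function -/

section TypewriterBounds

variable {q : ℕ} {ε : ℝ}

theorem typewriter_nonneg (hε0 : 0 ≤ ε) (hε : ε ≤ 1) (x y : ZMod q) : 0 ≤ typewriter q ε x y := by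
  unfold typewriter
  split_ifs <;> linarith

/-- Words of letters that are pairwise equal or adjacent have a common output word whose
probability is at least `ε ^ n` given either of them. -/
theorem exists_common_output (hε0 : 0 < ε) (hε : ε ≤ 1 / 2) {n : ℕ} (x x' : Fin n → ZMod q)
    (h : ∀ i, x i = x' i ∨ x i = x' i + 1 ∨ x' i = x i + 1) :
    ∃ y : Fin n → ZMod q, ε ^ n ≤ ∏ i, typewriter q ε (x i) (y i) ∧
      ε ^ n ≤ ∏ i, typewriter q ε (x' i) (y i) := by
  have key : ∀ i, ∃ z, ε ≤ typewriter q ε (x i) z ∧ ε ≤ typewriter q ε (x' i) z := by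
    intro i
    -- Letters a and a + 1 meet at the output a + 1; `ε ≤ 1 / 2` makes the noiseless probability at
    -- least ε as well.
    rcases h i with h | h | h
    · refine ⟨x i, ?_, ?_⟩ <;> simp [typewriter, h] <;> linarith
    · refine ⟨x i, ?_, ?_⟩ <;> simp only [typewriter, h] <;> split_ifs <;> simp_all <;> linarith
    · refine ⟨x' i, ?_, ?_⟩ <;> simp only [typewriter, h] <;> split_ifs <;> simp_all <;> linarith
  choose y hy using key
  refine ⟨y, ?_, ?_⟩
  · calc ε ^ n = ∏ _i : Fin n, ε := by simp
      _ ≤ _ := Finset.prod_le_prod (fun _ _ => hε0.le) fun i _ => (hy i).1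
  · calc ε ^ n = ∏ _i : Fin n, ε := by simp
      _ ≤ _ := Finset.prod_le_prod (fun _ _ => hε0.le) fun i _ => (hy i).2

/-- The messages whose conditional error probability is below `ε ^ n` number at most
`θ(C_q) ^ n`. -/
theorem card_small_error_le [NeZero q] (hq3 : 3 ≤ q) (hq : Odd q) (hε0 : 0 < ε) (hε : ε ≤ 1 / 2)
    {M n : ℕ} (b : Fin M → Fin n → ZMod q) (dec : (Fin n → ZMod q) → Fin M) (S : Finset (Fin M))
    (hS : ∀ m ∈ S, (∑ y : Fin n → ZMod q,
      if dec y = m then 0 else ∏ i, typewriter q ε (b m i) (y i)) < ε ^ n) :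
    (S.card : ℝ) ≤ lovaszTheta (SimpleGraph.cycleGraph q) ^ n := by
  obtain ⟨t, ht, -⟩ := exists_orthonormalRep_cycleGraph hq3 hq
  refine card_le_lovaszTheta_pow ⟨t, ht⟩ S (fun m i => (ZMod.finEquiv q).symm (b m i)) ?_
  intro m hm m' hm' hne
  -- The decoder assigns the common output to at most one of the two messages, so the other has
  -- error at least `ε ^ n`.
  by_contra! hcon
  obtain ⟨y, hy, hy'⟩ := exists_common_output hε0 hε (b m) (b m') (fun i => by
    by_cases h : b m i = b m' i
    · exact Or.inl h
    · have := hcon i (fun h' => h ((ZMod.finEquiv q).symm.injective h'))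
      rw [cycleGraph_adj_finEquiv (by omega)] at this
      exact Or.inr this)
  have hle : ∀ m₀, dec y ≠ m₀ → ∏ i, typewriter q ε (b m₀ i) (y i) ≤ ∑ y : Fin n → ZMod q,
      if dec y = m₀ then 0 else ∏ i, typewriter q ε (b m₀ i) (y i) := by
    intro m₀ h₀
    have := Finset.single_le_sum (f := fun y : Fin n → ZMod q =>
      if dec y = m₀ then 0 else ∏ i, typewriter q ε (b m₀ i) (y i)) (s := Finset.univ)
      (fun y _ => by
        split_ifs
        · exact le_rfl
        · exact Finset.prod_nonneg fun i _ => typewriter_nonneg hε0.le (by linarith) _ _)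
      (Finset.mem_univ y)
    simpa [h₀] using this
  by_cases h : dec y = m
  · have h2 : dec y ≠ m' := fun h' => hne (h.symm.trans h')
    exact absurd (hS m' hm') (not_lt.2 (hy'.trans (hle m' h2)))
  · exact absurd (hS m hm) (not_lt.2 (hy.trans (hle m h)))

/-- Output word obtained from `x` when the noise is the indicator of `s`. -/
def shiftOn {n : ℕ} (x : Fin n → ZMod q) (s : Finset (Fin n)) (i : Fin n) : ZMod q :=
  if i ∈ s then x i + 1 else x i

theorem shiftOn_injective (hz : (1 : ZMod q) ≠ 0) {n : ℕ} (x : Fin n → ZMod q) :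
    Function.Injective (shiftOn x) := by
  intro s t h
  ext i
  have := congrFun h i
  unfold shiftOn at this
  by_cases h1 : i ∈ s <;> by_cases h2 : i ∈ t <;> simp_all

theorem prod_typewriter_shiftOn (hz : (1 : ZMod q) ≠ 0) {n : ℕ} (x : Fin n → ZMod q)
    (s : Finset (Fin n)) :
    ∏ i, typewriter q ε (x i) (shiftOn x s i) = ε ^ s.card * (1 - ε) ^ (n - s.card) := by
  have h : ∀ i, typewriter q ε (x i) (shiftOn x s i) = if i ∈ s then ε else 1 - ε := by
    intro i
    unfold typewriter shiftOn
    by_cases hi : i ∈ s <;> simp [hi, hz]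
  simp only [h]
  rw [Finset.prod_ite, Finset.prod_const, Finset.prod_const]
  congr 2
  · simp
  · rw [← Finset.compl_filter, Finset.card_compl]; simp

/-- The probability of the outputs outside `T` is at least that of the noise words of weight `k`
leading there, in number at least `n.choose k - T.card`. -/
theorem sum_outside_ge [NeZero q] (hz : (1 : ZMod q) ≠ 0) (hε0 : 0 ≤ ε) (hε : ε ≤ 1) {n k : ℕ}
    (x : Fin n → ZMod q) (T : Finset (Fin n → ZMod q)) :
    ε ^ k * (1 - ε) ^ (n - k) * ((n.choose k : ℝ) - T.card) ≤
      ∑ y : Fin n → ZMod q, if y ∈ T then 0 else ∏ i, typewriter q ε (x i) (y i) := by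
  classical
  set F : (Fin n → ZMod q) → ℝ := fun y =>
    if y ∈ T then 0 else ∏ i, typewriter q ε (x i) (y i) with hF
  have hF0 : ∀ y, 0 ≤ F y := by
    intro y
    simp only [hF]
    split_ifs
    · exact le_rfl
    · exact Finset.prod_nonneg fun i _ => typewriter_nonneg hε0 hε _ _
  have h1 : ∑ s ∈ Finset.powersetCard k Finset.univ, F (shiftOn x s) ≤ ∑ y, F y := by
    rw [← Finset.sum_image (f := F) (g := shiftOn x) (fun a _ b _ h => shiftOn_injective hz x h)]
    exact Finset.sum_le_sum_of_subset_of_nonneg (Finset.subset_univ _) fun _ _ _ => hF0 _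
  refine le_trans ?_ h1
  have hu : 0 ≤ ε ^ k * (1 - ε) ^ (n - k) := by
    have : 0 ≤ 1 - ε := by linarith
    positivity
  have h2 : ∀ s ∈ Finset.powersetCard k (Finset.univ : Finset (Fin n)),
      ε ^ k * (1 - ε) ^ (n - k) * (1 - if shiftOn x s ∈ T then 1 else 0) ≤ F (shiftOn x s) := by
    intro s hs
    rw [Finset.mem_powersetCard] at hs
    simp only [hF]
    split_ifs
    · simp
    · rw [prod_typewriter_shiftOn hz, hs.2]; simp
  refine le_trans ?_ (Finset.sum_le_sum h2)
  rw [← Finset.mul_sum, Finset.sum_sub_distrib]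
  refine mul_le_mul_of_nonneg_left ?_ hu
  have h3 : ((Finset.powersetCard k (Finset.univ : Finset (Fin n))).filter
      fun s => shiftOn x s ∈ T).card ≤ T.card :=
    Finset.card_le_card_of_injOn (shiftOn x) (fun s hs => (Finset.mem_filter.1 hs).2)
      fun a _ b _ h => shiftOn_injective hz x h
  have h3' : (((Finset.powersetCard k (Finset.univ : Finset (Fin n))).filter
      fun s => shiftOn x s ∈ T).card : ℝ) ≤ T.card := by exact_mod_cast h3
  simp only [Finset.sum_const, Finset.card_powersetCard, Finset.card_univ, Fintype.card_fin,
    nsmul_eq_mul, mul_one, Finset.sum_boole]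
  linarith

/-- Given the first-block output `y`, message `m` errs with probability `p m y`. The pairs with `p m
y < ε ^ n₂` are counted in two ways: at most θ ^ n₂ messages for each `y`, hence at most q ^ n₁ θ ^
n₂ pairs in all. Outside them, first-block noise of weight `k` costs a further factor `ε ^ n₂`. -/
theorem avgErrorProb_typewriter_ge [NeZero q] (hq3 : 3 ≤ q) (hq : Odd q) (hε0 : 0 < ε)
    (hε : ε ≤ 1 / 2) {M n₁ n₂ : ℕ} (hM : 0 < M) (k : ℕ) (enc : Fin M → Fin (n₁ + n₂) → ZMod q)
    (dec : (Fin (n₁ + n₂) → ZMod q) → Fin M) :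
    ε ^ n₂ * (ε ^ k * (1 - ε) ^ (n₁ - k) *
      ((n₁.choose k : ℝ) - lovaszTheta (SimpleGraph.cycleGraph q) ^ n₂ * q ^ n₁ / M)) ≤
      avgErrorProb (typewriter q ε) enc dec := by
  classical
  have hz : (1 : ZMod q) ≠ 0 := by
    have : Fact (1 < q) := ⟨by omega⟩
    exact one_ne_zero
  set θ := lovaszTheta (SimpleGraph.cycleGraph q)
  set u := ε ^ k * (1 - ε) ^ (n₁ - k) with hu
  have hu0 : 0 ≤ u := by
    have : 0 ≤ 1 - ε := by linarith
    positivity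
  let P₁ : Fin M → (Fin n₁ → ZMod q) → ℝ := fun m y =>
    ∏ i, typewriter q ε (enc m (Fin.castAdd n₂ i)) (y i)
  let p : Fin M → (Fin n₁ → ZMod q) → ℝ := fun m y => ∑ z : Fin n₂ → ZMod q,
    if dec (Fin.append y z) = m then 0 else
      ∏ i, typewriter q ε (enc m (Fin.natAdd n₁ i)) (z i)
  have hP₁ : ∀ m y, 0 ≤ P₁ m y := fun m y =>
    Finset.prod_nonneg fun i _ => typewriter_nonneg hε0.le (by linarith) _ _
  have hp : ∀ m y, 0 ≤ p m y := fun m y => Finset.sum_nonneg fun z _ => by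
    split_ifs
    · exact le_rfl
    · exact Finset.prod_nonneg fun i _ => typewriter_nonneg hε0.le (by linarith) _ _
  have hsplit : ∀ m, (∑ y : Fin (n₁ + n₂) → ZMod q,
      if dec y = m then 0 else ∏ i, typewriter q ε (enc m i) (y i)) = ∑ y, P₁ m y * p m y := by
    intro m
    rw [← Equiv.sum_comp (Fin.appendEquiv n₁ n₂), Fintype.sum_prod_type]
    refine Finset.sum_congr rfl fun y _ => ?_
    simp only [P₁, p, Finset.mul_sum]
    refine Finset.sum_congr rfl fun z _ => ?_
    simp only [Fin.appendEquiv, Equiv.coe_fn_mk]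
    rw [Fin.prod_univ_add]
    simp only [Fin.append_left, Fin.append_right, mul_ite, mul_zero]
  let S : (Fin n₁ → ZMod q) → Finset (Fin M) := fun y =>
    Finset.univ.filter fun m => p m y < ε ^ n₂
  let T : Fin M → Finset (Fin n₁ → ZMod q) := fun m =>
    Finset.univ.filter fun y => p m y < ε ^ n₂
  have hS : ∀ y, ((S y).card : ℝ) ≤ θ ^ n₂ := by
    intro y
    refine card_small_error_le hq3 hq hε0 hε (fun m i => enc m (Fin.natAdd n₁ i))
      (fun z => dec (Fin.append y z)) (S y) fun m hm => (Finset.mem_filter.1 hm).2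
  have hST : ∑ m, ((T m).card : ℝ) ≤ q ^ n₁ * θ ^ n₂ := by
    have e : ∑ m, ((T m).card : ℝ) = ∑ y, ((S y).card : ℝ) := by
      simp only [T, S, Finset.card_filter]
      push_cast
      exact Finset.sum_comm
    rw [e]
    refine (Finset.sum_le_sum fun y _ => hS y).trans (le_of_eq ?_)
    simp [ZMod.card]
  have hm : ∀ m, ε ^ n₂ * (u * ((n₁.choose k : ℝ) - (T m).card)) ≤ ∑ y, P₁ m y * p m y := by
    intro m
    have h1 := sum_outside_ge hz hε0.le (by linarith : ε ≤ 1) (k := k)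
      (fun i => enc m (Fin.castAdd n₂ i)) (T m)
    refine (mul_le_mul_of_nonneg_left h1 (by positivity)).trans ?_
    rw [Finset.mul_sum]
    refine Finset.sum_le_sum fun y _ => ?_
    split_ifs with hy
    · rw [mul_zero]; exact mul_nonneg (hP₁ m y) (hp m y)
    · rw [mul_comm]
      refine mul_le_mul_of_nonneg_left ?_ (hP₁ m y)
      simpa [T] using hy
  have hM' : (0 : ℝ) < M := by exact_mod_cast hM
  unfold avgErrorProb
  simp only [hsplit]
  rw [one_div, inv_mul_eq_div, le_div_iff₀ hM']
  refine le_trans ?_ (Finset.sum_le_sum fun m _ => hm m)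
  rw [← Finset.mul_sum, ← Finset.mul_sum, Finset.sum_sub_distrib, mul_assoc, mul_assoc]
  refine mul_le_mul_of_nonneg_left (mul_le_mul_of_nonneg_left ?_ hu0) (by positivity)
  rw [sub_mul, div_mul_cancel₀ _ hM'.ne']
  simp only [Finset.sum_const, Finset.card_univ, Fintype.card_fin, nsmul_eq_mul]
  linarith

theorem minErrorProb_typewriter_ge [NeZero q] (hq3 : 3 ≤ q) (hq : Odd q) (hε0 : 0 < ε)
    (hε : ε ≤ 1 / 2) {M n₁ n₂ : ℕ} (hM : 0 < M) (k : ℕ) :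
    ε ^ n₂ * (ε ^ k * (1 - ε) ^ (n₁ - k) *
      ((n₁.choose k : ℝ) - lovaszTheta (SimpleGraph.cycleGraph q) ^ n₂ * q ^ n₁ / M)) ≤
      minErrorProb (typewriter q ε) M (n₁ + n₂) := by
  have : Nonempty (Fin M) := ⟨⟨0, hM⟩⟩
  exact le_ciInf fun c => avgErrorProb_typewriter_ge hq3 hq hε0 hε hM k c.1 c.2

/-- Gallager's function of the typewriter channel; the uniform input distribution is optimal. -/
theorem gallagerE0_typewriter [NeZero q] (hq2 : 2 ≤ q) (hε0 : 0 < ε) (hε : ε < 1) {ρ : ℝ}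
    (hρ : 0 ≤ ρ) :
    gallagerE0 (typewriter q ε) ρ = ρ * Real.logb 2 q -
      (1 + ρ) * Real.logb 2 (ε ^ (1 / (1 + ρ)) + (1 - ε) ^ (1 / (1 + ρ))) := by
  have hz : (1 : ZMod q) ≠ 0 := by
    have : Fact (1 < q) := ⟨by omega⟩
    exact one_ne_zero
  have hq0 : (0 : ℝ) < q := by exact_mod_cast (by omega : 0 < q)
  set s := 1 / (1 + ρ) with hs
  have hs0 : s ≠ 0 := by positivity
  have hε1 : 0 < 1 - ε := by linarith
  set S := ε ^ s + (1 - ε) ^ s with hS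
  have hS0 : 0 < S := by positivity
  have hw : ∀ x y : ZMod q, typewriter q ε x y ^ s =
      (if y = x then (1 - ε) ^ s else 0) + if x = y - 1 then ε ^ s else 0 := by
    intro x y
    unfold typewriter
    simp only [show (x = y - 1) ↔ (y = x + 1) by rw [eq_sub_iff_add_eq, eq_comm]]
    by_cases h1 : y = x
    · simp [h1, hz]
    · by_cases h2 : y = x + 1
      · simp [h2, hz]
      · simp [h1, h2, Real.zero_rpow hs0]
  have hin : ∀ (P : ZMod q → ℝ) (y : ZMod q), ∑ x, P x * typewriter q ε x y ^ s =
      P y * (1 - ε) ^ s + P (y - 1) * ε ^ s := by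
    intro P y
    simp only [hw, mul_add, Finset.sum_add_distrib, mul_ite, mul_zero]
    simp
  have hval : ((q : ℝ) * (1 / q * S) ^ (1 + ρ)) = q ^ (-ρ) * S ^ (1 + ρ) := by
    rw [Real.mul_rpow (by positivity) hS0.le, ← mul_assoc]
    congr 1
    rw [one_div, Real.inv_rpow hq0.le, ← Real.rpow_neg hq0.le]
    nth_rw 1 [← Real.rpow_one (q : ℝ)]
    rw [← Real.rpow_add hq0]
    congr 1; ring
  have hlog : -Real.logb 2 (q ^ (-ρ) * S ^ (1 + ρ)) = ρ * Real.logb 2 q - (1 + ρ) * Real.logb 2 S := by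
    rw [Real.logb_mul (by positivity) (by positivity), Real.logb_rpow_eq_mul_logb_of_pos hq0,
      Real.logb_rpow_eq_mul_logb_of_pos hS0]
    ring
  have hbound : ∀ P : stdSimplex ℝ (ZMod q),
      -Real.logb 2 (∑ y, (∑ x, P.1 x * typewriter q ε x y ^ s) ^ (1 + ρ)) ≤
        ρ * Real.logb 2 q - (1 + ρ) * Real.logb 2 S := by
    intro P
    rw [← hlog, neg_le_neg_iff]
    refine Real.logb_le_logb_of_le (by norm_num) (by positivity) ?_
    simp only [hin]
    have h0 : ∀ y, 0 ≤ P.1 y * (1 - ε) ^ s + P.1 (y - 1) * ε ^ s := by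
      intro y
      have h1 := P.2.1 y
      have h2 := P.2.1 (y - 1)
      positivity
    -- Jensen for the power 1 + ρ: the inner sums add up to `S` over all outputs, whatever `P` is,
    -- and are all equal for uniform `P`.
    have hJ := Real.rpow_arith_mean_le_arith_mean_rpow Finset.univ (fun _ : ZMod q => 1 / (q : ℝ))
      (fun y => P.1 y * (1 - ε) ^ s + P.1 (y - 1) * ε ^ s) (fun _ _ => by positivity)
      (by simp [ZMod.card]) (fun y _ => h0 y) (p := 1 + ρ) (by linarith)
    rw [← Finset.mul_sum, ← Finset.mul_sum] at hJ
    have hsum : ∑ y, (P.1 y * (1 - ε) ^ s + P.1 (y - 1) * ε ^ s) = S := by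
      rw [Finset.sum_add_distrib, ← Finset.sum_mul, ← Finset.sum_mul,
        show ∑ y, P.1 (y - 1) = ∑ y, P.1 y from Equiv.sum_comp (Equiv.subRight (1 : ZMod q)) P.1,
        show ∑ y, P.1 y = 1 from P.2.2, hS]
      ring
    rw [hsum] at hJ
    rw [← hval]
    calc (q : ℝ) * (1 / q * S) ^ (1 + ρ) ≤ q * _ := mul_le_mul_of_nonneg_left hJ hq0.le
      _ = _ := by rw [← mul_assoc, mul_one_div_cancel hq0.ne', one_mul]
  let U : stdSimplex ℝ (ZMod q) := ⟨fun _ => 1 / (q : ℝ), fun _ => by positivity, by simp [ZMod.card]⟩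
  have : Nonempty (stdSimplex ℝ (ZMod q)) := ⟨U⟩
  refine le_antisymm (ciSup_le hbound) ?_
  refine le_trans (le_of_eq ?_) (le_ciSup ⟨_, Set.forall_mem_range.2 hbound⟩ U)
  rw [← hlog, ← hval]
  simp only [hin, U, Finset.sum_const, Finset.card_univ, ZMod.card, nsmul_eq_mul]
  rw [hS, ← mul_add, add_comm]

end TypewriterBounds

/-! ### Tangents of a conjugate function -/

section Legendre

/-- A concave function on `[0, ∞)` given by its tangent lines: the tangent of `E` at `ρ` has slope
`r ρ` and intercept `D ρ`. -/
structure HasTangents (E r D : ℝ → ℝ) : Prop where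
  eq : ∀ ρ, 0 ≤ ρ → E ρ = ρ * r ρ + D ρ
  le : ∀ ρ, 0 ≤ ρ → ∀ ρ', 0 ≤ ρ' → E ρ' ≤ ρ' * r ρ + D ρ
  continuousOn : ContinuousOn r (Set.Ici 0)

/-- The conjugate `R ↦ sup_{ρ ≥ 0} (E ρ - ρ R)`. -/
noncomputable def conjugate (E : ℝ → ℝ) (R : ℝ) : EReal :=
  ⨆ ρ : {ρ : ℝ // 0 ≤ ρ}, ((E ρ.1 - ρ.1 * R : ℝ) : EReal)

variable {E r D : ℝ → ℝ} {R₀ e₀ : ℝ}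

theorem le_conjugate {ρ : ℝ} (hρ : 0 ≤ ρ) (R : ℝ) :
    ((E ρ - ρ * R : ℝ) : EReal) ≤ conjugate E R :=
  le_iSup (fun ρ : {ρ : ℝ // 0 ≤ ρ} => ((E ρ.1 - ρ.1 * R : ℝ) : EReal)) ⟨ρ, hρ⟩

theorem conjugate_le {c R : ℝ} (h : ∀ ρ, 0 ≤ ρ → E ρ - ρ * R ≤ c) : conjugate E R ≤ (c : EReal) :=
  iSup_le fun ρ => by exact_mod_cast h ρ.1 ρ.2

/-- Intermediate values of E ρ - ρ R₀, which is 0 at 0 and at least `e₀` at ρ = e₀ / (c - R₀). -/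
theorem exists_intercept (hE : ContinuousOn E (Set.Ici 0)) (hE0 : E 0 = 0)
    (he₀ : 0 < e₀) {c : ℝ} (hc : R₀ < c) (hgrow : ∀ ρ, 0 ≤ ρ → ρ * c ≤ E ρ) :
    ∃ ρ, 0 < ρ ∧ E ρ = e₀ + ρ * R₀ := by
  have hc' : 0 < c - R₀ := sub_pos.2 hc
  set b := e₀ / (c - R₀) with hb
  have hb0 : 0 < b := by positivity
  have hcont : ContinuousOn (fun ρ => E ρ - ρ * R₀) (Set.Icc 0 b) :=
    (hE.mono Set.Icc_subset_Ici_self).sub (by fun_prop)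
  have hbc : b * (c - R₀) = e₀ := by rw [hb]; field_simp
  obtain ⟨ρ, hρ, hρe⟩ := intermediate_value_Icc hb0.le hcont (show e₀ ∈ Set.Icc _ _ by
    constructor
    · simp [hE0, he₀.le]
    · have := hgrow b hb0.le
      linarith)
  refine ⟨ρ, lt_of_le_of_ne hρ.1 ?_, by simp only at hρe; linarith⟩
  rintro rfl
  simp [hE0] at hρe
  linarith

namespace HasTangents

/-- The tangent at `ρ` bounds every competitor by `D ρ`, with equality at `ρ` itself; thus (r ρ, D
ρ) parametrizes points of the curve. -/
theorem conjugate_eq (h : HasTangents E r D) {ρ : ℝ} (hρ : 0 ≤ ρ) :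
    conjugate E (r ρ) = (D ρ : EReal) := by
  refine le_antisymm (conjugate_le fun ρ' hρ' => ?_) ?_
  · have := h.le ρ hρ ρ' hρ'; linarith
  · refine le_trans ?_ (le_conjugate hρ _)
    rw [h.eq ρ hρ]; simp

/-- A slope bound at an interior point determines the slope of the tangent. -/
theorem slope_unique (h : HasTangents E r D) {ρ R₁ : ℝ} (hρ : 0 < ρ)
    (hR : ∀ ρ', 0 ≤ ρ' → E ρ' ≤ E ρ + (ρ' - ρ) * R₁) : R₁ = r ρ := by
  have hc : ContinuousAt r ρ := h.continuousOn.continuousAt (Ici_mem_nhds hρ)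
  -- Adds the slope bound at `ρ` to the tangent inequality at `ρ'`. Letting `ρ'` tend to `ρ` from
  -- either side, continuity of `r` pins `R₁`.
  have hkey : ∀ ρ', 0 ≤ ρ' → (ρ' - ρ) * r ρ' ≤ (ρ' - ρ) * R₁ := by
    intro ρ' hρ'
    have h1 := hR ρ' hρ'
    have h2 := h.le ρ' hρ' ρ hρ.le
    rw [h.eq ρ' hρ'] at h1
    linarith
  refine le_antisymm ?_ ?_
  · refine ge_of_tendsto (hc.tendsto.mono_left (nhdsWithin_le_nhds (s := Set.Iio ρ))) ?_
    filter_upwards [Ioo_mem_nhdsLT hρ] with ρ' hρ'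
    nlinarith [hkey ρ' hρ'.1.le, hρ'.2]
  · refine le_of_tendsto (hc.tendsto.mono_left (nhdsWithin_le_nhds (s := Set.Ioi ρ))) ?_
    filter_upwards [self_mem_nhdsWithin] with ρ' hρ'
    have hρ' : ρ < ρ' := hρ'
    nlinarith [hkey ρ' (hρ.trans hρ').le]

theorem strictMono_sub (h : HasTangents E r D) (hR₀ : ∀ ρ, 0 ≤ ρ → R₀ < r ρ) {ρ ρ' : ℝ}
    (hρ : 0 ≤ ρ) (hlt : ρ < ρ') : E ρ - ρ * R₀ < E ρ' - ρ' * R₀ := by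
  have h1 := h.le ρ' (hρ.trans hlt.le) ρ hρ
  have h2 := h.eq ρ' (hρ.trans hlt.le)
  have h3 := hR₀ ρ' (hρ.trans hlt.le)
  nlinarith [mul_pos (sub_pos.2 hlt) (sub_pos.2 h3)]

theorem slopeThrough_eq (h : HasTangents E r D) {ρ : ℝ} (hρ : 0 < ρ) (hρe : E ρ = e₀ + ρ * R₀)
    (hR : R₀ < r ρ) : slopeThrough R₀ e₀ (r ρ) (conjugate E (r ρ)).toReal = -ρ := by
  rw [h.conjugate_eq hρ.le, EReal.toReal_coe, slopeThrough, div_eq_iff (sub_pos.2 hR).ne']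
  have := h.eq ρ hρ.le
  linarith

theorem isTangentAt (h : HasTangents E r D) {ρ : ℝ} (hρ : 0 < ρ) (hρe : E ρ = e₀ + ρ * R₀)
    (hR : R₀ < r ρ) : IsTangentAt (conjugate E) R₀ e₀ (r ρ) := by
  refine ⟨hR, ?_, ?_, fun R => ?_⟩
  · rw [h.conjugate_eq hρ.le]; exact EReal.coe_ne_top _
  · rw [h.conjugate_eq hρ.le]; exact EReal.coe_ne_bot _
  · refine le_trans (le_of_eq ?_) (le_conjugate hρ.le R)
    rw [lineThrough, h.slopeThrough_eq hρ hρe hR]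
    congr 1
    linarith

/-- With -ρ the slope of the line, lying below the curve at `r ρ` gives E ρ ≥ e₀ + ρ R₀, and the
value of the curve at `R₁` gives the reverse. -/
theorem eq_of_isTangentAt (h : HasTangents E r D) (hD0 : D 0 = 0) (he₀ : 0 < e₀) {R₁ : ℝ}
    (hT : IsTangentAt (conjugate E) R₀ e₀ R₁) :
    ∃ ρ, 0 < ρ ∧ E ρ = e₀ + ρ * R₀ ∧ R₁ = r ρ := by
  obtain ⟨hR, htop, hbot, hline⟩ := hT
  set c := (conjugate E R₁).toReal with hc
  have hcR : conjugate E R₁ = (c : EReal) := (EReal.coe_toReal htop hbot).symm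
  obtain ⟨ρ, hρ⟩ : ∃ ρ, ρ = -slopeThrough R₀ e₀ R₁ c := ⟨_, rfl⟩
  have hl : ∀ R, lineThrough R₀ e₀ R₁ c R = e₀ + ρ * R₀ - ρ * R := by
    intro R; rw [lineThrough, hρ]; ring
  have hcl : c = e₀ + ρ * R₀ - ρ * R₁ := by
    have : slopeThrough R₀ e₀ R₁ c * (R₁ - R₀) = c - e₀ := by
      rw [slopeThrough, div_mul_cancel₀ _ (sub_pos.2 hR).ne']
    rw [hρ]; linarith
  -- Beyond `r 0` the conjugate is at most 0. A line of nonnegative slope starting at height `e₀ >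
  -- 0` would exceed it there, so ρ > 0.
  have hle : ∀ R, r 0 ≤ R → e₀ + ρ * R₀ - ρ * R ≤ 0 := by
    intro R h0R
    have h1 := (hline R).trans (conjugate_le (c := 0) fun ρ' hρ' => by
      have := h.le 0 le_rfl ρ' hρ'
      rw [hD0] at this
      nlinarith [mul_le_mul_of_nonneg_left h0R hρ'])
    rw [hl] at h1
    exact_mod_cast h1
  have hρ0 : 0 < ρ := by
    by_contra! hneg
    have := hle (max (r 0) R₀) (le_max_left _ _)
    nlinarith [mul_le_mul_of_nonpos_left (le_max_right (r 0) R₀) hneg]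
  have h1 : e₀ + ρ * R₀ ≤ E ρ := by
    have := hline (r ρ)
    rw [hl, h.conjugate_eq hρ0.le] at this
    have : e₀ + ρ * R₀ - ρ * r ρ ≤ D ρ := by exact_mod_cast this
    have := h.eq ρ hρ0.le
    linarith
  have hub : ∀ ρ', 0 ≤ ρ' → E ρ' - ρ' * R₁ ≤ c := by
    intro ρ' hρ'
    have := le_conjugate (E := E) hρ' R₁
    rw [hcR] at this
    exact_mod_cast this
  have h2 : E ρ = e₀ + ρ * R₀ := by have := hub ρ hρ0.le; linarith
  refine ⟨ρ, hρ0, h2, h.slope_unique hρ0 fun ρ' hρ' => ?_⟩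
  have := hub ρ' hρ'
  linarith

theorem intercept_unique (h : HasTangents E r D) (hR₀ : ∀ ρ, 0 ≤ ρ → R₀ < r ρ) {ρ ρ' : ℝ}
    (hρ : 0 < ρ) (hρe : E ρ = e₀ + ρ * R₀) (hρ' : 0 < ρ') (hρe' : E ρ' = e₀ + ρ' * R₀) :
    ρ = ρ' := by
  rcases lt_trichotomy ρ ρ' with hlt | heq | hlt
  · have := h.strictMono_sub hR₀ hρ.le hlt; linarith
  · exact heq
  · have := h.strictMono_sub hR₀ hρ'.le hlt; linarith

/-- Strict monotonicity and continuity of `r` write each R near `r ρ` as `r ρ'` with `ρ'` near `ρ`.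
The tangent inequalities at both points put the linearization error between 0 and (ρ - ρ')(r ρ' - r
ρ). -/
theorem hasDerivAt_conjugate (h : HasTangents E r D) (hr : StrictAntiOn r (Set.Ici 0)) {ρ : ℝ}
    (hρ : 0 < ρ) : HasDerivAt (fun R => (conjugate E R).toReal) (-ρ) (r ρ) := by
  rw [hasDerivAt_iff_isLittleO, Asymptotics.isLittleO_iff]
  intro η hη
  set κ := min η (ρ / 2) with hκ
  have hκ0 : 0 < κ := by positivity
  have hκρ : κ ≤ ρ / 2 := min_le_right _ _
  have ha : 0 ≤ ρ - κ := by linarith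
  have h1 : r ρ < r (ρ - κ) := hr (Set.mem_Ici.2 ha) (Set.mem_Ici.2 hρ.le) (by linarith)
  have h2 : r (ρ + κ) < r ρ :=
    hr (Set.mem_Ici.2 hρ.le) (Set.mem_Ici.2 (by linarith)) (by linarith)
  filter_upwards [Ioo_mem_nhds h2 h1] with R hR
  obtain ⟨ρ', hρ', rfl⟩ := intermediate_value_Icc' (by linarith : ρ - κ ≤ ρ + κ)
    (h.continuousOn.mono fun x hx => Set.mem_Ici.2 (ha.trans hx.1)) ⟨hR.1.le, hR.2.le⟩
  have hρ'0 : 0 ≤ ρ' := ha.trans hρ'.1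
  rw [h.conjugate_eq hρ.le, h.conjugate_eq hρ'0, EReal.toReal_coe, EReal.toReal_coe, smul_eq_mul,
    Real.norm_eq_abs, Real.norm_eq_abs]
  have e1 := h.eq ρ hρ.le
  have e2 := h.eq ρ' hρ'0
  have i1 := h.le ρ hρ.le ρ' hρ'0
  have i2 := h.le ρ' hρ'0 ρ hρ.le
  have hd : |ρ - ρ'| ≤ η := by
    have : κ ≤ η := min_le_left _ _
    rw [abs_le]; constructor <;> linarith [hρ'.1, hρ'.2]
  rw [abs_of_nonneg (by linarith)]
  calc D ρ' - D ρ - (r ρ' - r ρ) * -ρ ≤ (ρ - ρ') * (r ρ' - r ρ) := by linarith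
    _ ≤ |(ρ - ρ') * (r ρ' - r ρ)| := le_abs_self _
    _ = |ρ - ρ'| * |r ρ' - r ρ| := abs_mul _ _
    _ ≤ η * |r ρ' - r ρ| := mul_le_mul_of_nonneg_right hd (abs_nonneg _)

end HasTangents

end Legendre

/-! ### Parametrizing the sphere-packing curve by tilted noise -/

section Tilting

/-- Bernoulli parameter of the noise of level `ε` tilted by the exponent `1 / (1 + ρ)`. -/
noncomputable def tilt (ε ρ : ℝ) : ℝ :=
  ε ^ (1 / (1 + ρ)) / (ε ^ (1 / (1 + ρ)) + (1 - ε) ^ (1 / (1 + ρ)))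

/-- Binary relative entropy in bits. -/
noncomputable def binDiv (δ ε : ℝ) : ℝ :=
  (-Real.binEntropy δ - (δ * Real.log ε + (1 - δ) * Real.log (1 - ε))) / Real.log 2

/-- Gallager's function of the typewriter channel in closed form. -/
noncomputable def typewriterE0 (q : ℕ) (ε ρ : ℝ) : ℝ := ρ * Real.logb 2 q -
  (1 + ρ) * Real.logb 2 (ε ^ (1 / (1 + ρ)) + (1 - ε) ^ (1 / (1 + ρ)))

/-- The rate at which `ρ` is optimal in the sphere-packing exponent. -/
noncomputable def tiltRate (q : ℕ) (ε ρ : ℝ) : ℝ := Real.logb 2 q - Real.binEntropy (tilt ε ρ) / Real.log 2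

variable {q : ℕ} {ε : ℝ}

theorem tilt_pos (hε0 : 0 < ε) (hε1 : ε < 1) (ρ : ℝ) : 0 < tilt ε ρ := by
  have : 0 < 1 - ε := by linarith
  unfold tilt; positivity

theorem one_sub_tilt (hε0 : 0 < ε) (hε1 : ε < 1) (ρ : ℝ) : 1 - tilt ε ρ =
    (1 - ε) ^ (1 / (1 + ρ)) / (ε ^ (1 / (1 + ρ)) + (1 - ε) ^ (1 / (1 + ρ))) := by
  have h1 : 0 < 1 - ε := by linarith
  have h2 : 0 < ε ^ (1 / (1 + ρ)) + (1 - ε) ^ (1 / (1 + ρ)) := by positivity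
  unfold tilt
  rw [eq_div_iff h2.ne', sub_mul, div_mul_cancel₀ _ h2.ne']
  ring

theorem tilt_lt_one (hε0 : 0 < ε) (hε1 : ε < 1) (ρ : ℝ) : tilt ε ρ < 1 := by
  have h1 : 0 < 1 - ε := by linarith
  have : 0 < 1 - tilt ε ρ := by rw [one_sub_tilt hε0 hε1]; positivity
  linarith

theorem tilt_zero (ε : ℝ) : tilt ε 0 = ε := by simp [tilt]

theorem continuousOn_tilt (hε0 : 0 < ε) (hε1 : ε < 1) : ContinuousOn (tilt ε) (Set.Ici 0) := by
  have h1 : 0 < 1 - ε := by linarith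
  have hs : ContinuousOn (fun ρ : ℝ => 1 / (1 + ρ)) (Set.Ici 0) := by
    refine continuousOn_const.div (by fun_prop) fun ρ hρ => ?_
    have : (0 : ℝ) ≤ ρ := hρ
    positivity
  have ha : ContinuousOn (fun ρ : ℝ => ε ^ (1 / (1 + ρ))) (Set.Ici 0) :=
    continuousOn_const.rpow hs fun _ _ => Or.inl hε0.ne'
  have hb : ContinuousOn (fun ρ : ℝ => (1 - ε) ^ (1 / (1 + ρ))) (Set.Ici 0) :=
    continuousOn_const.rpow hs fun _ _ => Or.inl h1.ne'
  exact ha.div (ha.add hb) fun ρ _ => by positivity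

/-- The odds of the tilted noise are (ε / (1 - ε)) ^ (1 / (1 + ρ)), with base below 1 and decreasing
exponent. At ε = 1/2 they would be constant. -/
theorem strictMonoOn_tilt (hε0 : 0 < ε) (hε : ε < 1 / 2) :
    StrictMonoOn (tilt ε) (Set.Ici 0) := by
  intro ρ hρ ρ' hρ' hlt
  have hρ : 0 ≤ ρ := hρ
  have hρ' : 0 ≤ ρ' := hρ'
  have h1 : 0 < 1 - ε := by linarith
  have hexp : 1 / (1 + ρ') < 1 / (1 + ρ) := one_div_lt_one_div_of_lt (by positivity) (by linarith)
  have key : (ε / (1 - ε)) ^ (1 / (1 + ρ)) < (ε / (1 - ε)) ^ (1 / (1 + ρ')) :=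
    Real.rpow_lt_rpow_of_exponent_gt (by positivity) (by rw [div_lt_one h1]; linarith) hexp
  rw [Real.div_rpow hε0.le h1.le, Real.div_rpow hε0.le h1.le,
    div_lt_div_iff₀ (by positivity) (by positivity)] at key
  unfold tilt
  rw [div_lt_div_iff₀ (by positivity) (by positivity)]
  linarith

theorem tilt_le_half (hε0 : 0 < ε) (hε : ε ≤ 1 / 2) {ρ : ℝ} (hρ : 0 ≤ ρ) :
    tilt ε ρ ≤ 2⁻¹ := by
  have h1 : 0 < 1 - ε := by linarith
  have key : ε ^ (1 / (1 + ρ)) ≤ (1 - ε) ^ (1 / (1 + ρ)) :=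
    Real.rpow_le_rpow hε0.le (by linarith) (by positivity)
  unfold tilt
  rw [div_le_iff₀ (by positivity)]
  linarith

theorem strictAntiOn_tiltRate (hε0 : 0 < ε) (hε : ε < 1 / 2) :
    StrictAntiOn (tiltRate q ε) (Set.Ici 0) := by
  intro ρ hρ ρ' hρ' hlt
  unfold tiltRate
  have h := Real.binEntropy_strictMonoOn
    ⟨(tilt_pos hε0 (by linarith) ρ).le, tilt_le_half hε0 hε.le hρ⟩
    ⟨(tilt_pos hε0 (by linarith) ρ').le, tilt_le_half hε0 hε.le hρ'⟩
    (strictMonoOn_tilt hε0 hε hρ hρ' hlt)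
  have := div_lt_div_of_pos_right h (Real.log_pos one_lt_two)
  linarith

theorem logb_half_le_tiltRate (hq : 0 < q) (ρ : ℝ) :
    Real.logb 2 (q / 2) ≤ tiltRate q ε ρ := by
  have hq0 : (q : ℝ) ≠ 0 := by exact_mod_cast hq.ne'
  rw [Real.logb_div hq0 two_ne_zero, Real.logb_self_eq_one one_lt_two, tiltRate]
  have := (div_le_one (Real.log_pos one_lt_two)).2 (Real.binEntropy_le_log_two (p := tilt ε ρ))
  linarith

/-- Gibbs' variational inequality for two-point sums. -/
theorem binEntropy_add_le_log {δ a b : ℝ} (hδ0 : 0 < δ) (hδ1 : δ < 1) (ha : 0 < a) (hb : 0 < b) :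
    Real.binEntropy δ + (δ * Real.log a + (1 - δ) * Real.log b) ≤ Real.log (a + b) := by
  have h1 : 0 < 1 - δ := by linarith
  have hab : 0 < a + b := by positivity
  have i1 := Real.log_le_sub_one_of_pos (x := a / (δ * (a + b))) (by positivity)
  have i2 := Real.log_le_sub_one_of_pos (x := b / ((1 - δ) * (a + b))) (by positivity)
  rw [Real.log_div ha.ne' (by positivity), Real.log_mul hδ0.ne' hab.ne'] at i1
  rw [Real.log_div hb.ne' (by positivity), Real.log_mul h1.ne' hab.ne'] at i2
  have j1 := mul_le_mul_of_nonneg_left i1 hδ0.le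
  have j2 := mul_le_mul_of_nonneg_left i2 h1.le
  have e1 : δ * (a / (δ * (a + b)) - 1) + (1 - δ) * (b / ((1 - δ) * (a + b)) - 1) = 0 := by
    field_simp; ring
  rw [Real.binEntropy_eq_negMulLog_add_negMulLog_one_sub, Real.negMulLog, Real.negMulLog]
  linarith

/-- Gibbs' inequality for the two powers, multiplied by 1 + ρ, is affine in ρ for each δ. Equality
at δ = `tilt ε ρ` makes these bounds the tangents. -/
theorem typewriterE0_le (hε0 : 0 < ε) (hε1 : ε < 1) {δ ρ : ℝ} (hδ0 : 0 < δ) (hδ1 : δ < 1)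
    (hρ : 0 ≤ ρ) : typewriterE0 q ε ρ ≤
      ρ * (Real.logb 2 q - Real.binEntropy δ / Real.log 2) + binDiv δ ε := by
  have h1 : 0 < 1 - ε := by linarith
  have hl := Real.log_pos one_lt_two
  have h := binEntropy_add_le_log hδ0 hδ1 (Real.rpow_pos_of_pos hε0 (1 / (1 + ρ)))
    (Real.rpow_pos_of_pos h1 (1 / (1 + ρ)))
  rw [Real.log_rpow hε0, Real.log_rpow h1] at h
  have h' := mul_le_mul_of_nonneg_left h (by positivity : 0 ≤ 1 + ρ)
  have e : (1 + ρ) * (Real.binEntropy δ + (δ * (1 / (1 + ρ) * Real.log ε) +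
      (1 - δ) * (1 / (1 + ρ) * Real.log (1 - ε)))) =
      (1 + ρ) * Real.binEntropy δ + (δ * Real.log ε + (1 - δ) * Real.log (1 - ε)) := by
    field_simp
  rw [e] at h'
  have h'' := div_le_div_of_nonneg_right h' hl.le
  rw [typewriterE0, binDiv, ← Real.log_div_log (x := ε ^ _ + _)]
  have e2 : (1 + ρ) * (Real.log (ε ^ (1 / (1 + ρ)) + (1 - ε) ^ (1 / (1 + ρ))) / Real.log 2) =
    ((1 + ρ) * Real.log (ε ^ (1 / (1 + ρ)) + (1 - ε) ^ (1 / (1 + ρ)))) / Real.log 2 := by ring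
  rw [e2]
  have e3 : ρ * (Real.logb 2 q - Real.binEntropy δ / Real.log 2) +
      (-Real.binEntropy δ - (δ * Real.log ε + (1 - δ) * Real.log (1 - ε))) / Real.log 2 =
      ρ * Real.logb 2 q - ((1 + ρ) * Real.binEntropy δ +
        (δ * Real.log ε + (1 - δ) * Real.log (1 - ε))) / Real.log 2 := by ring
  rw [e3]
  linarith

theorem typewriterE0_eq (hε0 : 0 < ε) (hε1 : ε < 1) {ρ : ℝ} (hρ : 0 ≤ ρ) :
    typewriterE0 q ε ρ = ρ * tiltRate q ε ρ + binDiv (tilt ε ρ) ε := by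
  have h1 : 0 < 1 - ε := by linarith
  have hl := Real.log_pos one_lt_two
  obtain ⟨S, hS⟩ : ∃ S, S = ε ^ (1 / (1 + ρ)) + (1 - ε) ^ (1 / (1 + ρ)) := ⟨_, rfl⟩
  have hS0 : 0 < S := by rw [hS]; positivity
  have l1 : Real.log (tilt ε ρ) = 1 / (1 + ρ) * Real.log ε - Real.log S := by
    rw [tilt, ← hS, Real.log_div (by positivity) hS0.ne', Real.log_rpow hε0]
  have l2 : Real.log (1 - tilt ε ρ) = 1 / (1 + ρ) * Real.log (1 - ε) - Real.log S := by
    rw [one_sub_tilt hε0 hε1, ← hS, Real.log_div (by positivity) hS0.ne', Real.log_rpow h1]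
  rw [typewriterE0, tiltRate, binDiv, ← Real.log_div_log (x := ε ^ _ + _), ← hS,
    Real.binEntropy_eq_negMulLog_add_negMulLog_one_sub, Real.negMulLog, Real.negMulLog, l1, l2]
  generalize tilt ε ρ = δ
  field_simp
  ring

theorem hasTangents_typewriterE0 (q : ℕ) (hε0 : 0 < ε) (hε1 : ε < 1) :
    HasTangents (typewriterE0 q ε) (tiltRate q ε) (fun ρ => binDiv (tilt ε ρ) ε) where
  eq _ hρ := typewriterE0_eq hε0 hε1 hρ
  le ρ _ _ hρ' := typewriterE0_le hε0 hε1 (tilt_pos hε0 hε1 ρ) (tilt_lt_one hε0 hε1 ρ) hρ'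
  continuousOn := continuousOn_const.sub
    ((Real.binEntropy_continuous.comp_continuousOn (continuousOn_tilt hε0 hε1)).div_const _)

theorem binDiv_self (ε : ℝ) : binDiv ε ε = 0 := by
  rw [binDiv, Real.binEntropy_eq_negMulLog_add_negMulLog_one_sub, Real.negMulLog, Real.negMulLog]
  ring

theorem binDiv_nonneg (hε0 : 0 < ε) (hε1 : ε < 1) {δ : ℝ} (hδ0 : 0 < δ) (hδ1 : δ < 1) :
    0 ≤ binDiv δ ε := by
  have h := binEntropy_add_le_log hδ0 hδ1 hε0 (by linarith : 0 < 1 - ε)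
  rw [add_sub_cancel, Real.log_one] at h
  exact div_nonneg (by linarith) (Real.log_pos one_lt_two).le

theorem continuousOn_typewriterE0 (q : ℕ) (hε0 : 0 < ε) (hε1 : ε < 1) :
    ContinuousOn (typewriterE0 q ε) (Set.Ici 0) := by
  refine ContinuousOn.congr (f := fun ρ => ρ * tiltRate q ε ρ + binDiv (tilt ε ρ) ε) ?_
    fun ρ hρ => typewriterE0_eq hε0 hε1 hρ
  have ht := continuousOn_tilt hε0 hε1
  refine (continuousOn_id.mul (hasTangents_typewriterE0 q hε0 hε1).continuousOn).add ?_
  unfold binDiv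
  have hB := Real.binEntropy_continuous.comp_continuousOn ht
  exact ((hB.neg).sub ((ht.mul continuousOn_const).add
    ((continuousOn_const.sub ht).mul continuousOn_const))).div_const _

theorem typewriterE0_zero (hε0 : 0 < ε) (hε1 : ε < 1) : typewriterE0 q ε 0 = 0 := by
  rw [typewriterE0_eq hε0 hε1 le_rfl, tilt_zero, binDiv_self]; simp

theorem mul_logb_half_le_typewriterE0 (hq : 0 < q) (hε0 : 0 < ε) (hε1 : ε < 1) {ρ : ℝ}
    (hρ : 0 ≤ ρ) : ρ * Real.logb 2 (q / 2) ≤ typewriterE0 q ε ρ := by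
  rw [typewriterE0_eq hε0 hε1 hρ]
  have h1 := mul_le_mul_of_nonneg_left (logb_half_le_tiltRate (ε := ε) hq ρ) hρ
  have h2 := binDiv_nonneg hε0 hε1 (tilt_pos hε0 hε1 ρ) (tilt_lt_one hε0 hε1 ρ)
  linarith

theorem spherePacking_typewriter [NeZero q] (hq : 2 ≤ q) (hε0 : 0 < ε) (hε1 : ε < 1) :
    spherePacking (typewriter q ε) = conjugate (typewriterE0 q ε) := by
  funext R
  unfold spherePacking conjugate
  exact iSup_congr fun ρ => by rw [gallagerE0_typewriter hq hε0 hε1 ρ.2, typewriterE0]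

end Tilting

/-! ### Exponents as the blocklength grows -/

section Asymptotics

/-- Some binomial coefficient near the mean is as large as the entropy bound up to a linear
factor. -/
theorem eventually_exists_choose_ge {δ : ℝ} (hδ0 : 0 < δ) (hδ1 : δ < 1) {η : ℝ} (hη : 0 < η) :
    ∀ᶠ N : ℕ in atTop, ∃ k ≤ N, |(k : ℝ) - N * δ| ≤ η * N ∧
      1 ≤ 2 * ((N : ℝ) + 1) * (N.choose k * δ ^ k * (1 - δ) ^ (N - k)) := by
  have hδ' : 0 < 1 - δ := by linarith
  filter_upwards [tendsto_natCast_atTop_atTop.eventually_ge_atTop (1 / η ^ 2),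
    eventually_gt_atTop 0] with N hN hN0
  have hN0' : (0 : ℝ) < N := by exact_mod_cast hN0
  set b : ℕ → ℝ := fun k => N.choose k * δ ^ k * (1 - δ) ^ (N - k) with hb
  have hb0 : ∀ k, 0 ≤ b k := fun k => by simp only [hb]; positivity
  have hsum : ∑ k ∈ Finset.range (N + 1), b k = 1 := by
    have := congrArg (Polynomial.eval δ) (bernsteinPolynomial.sum ℝ N)
    simpa [Polynomial.eval_finsetSum, bernsteinPolynomial] using this
  have hvar : ∑ k ∈ Finset.range (N + 1), (N * δ - k) ^ 2 * b k = N * δ * (1 - δ) := by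
    have := congrArg (Polynomial.eval δ) (bernsteinPolynomial.variance (R := ℝ) N)
    simpa [Polynomial.eval_finsetSum, bernsteinPolynomial] using this
  -- Chebyshev: otherwise the central binomial weights total at most 1/2 and the tails at most 1/4,
  -- short of 1.
  by_contra! hcon
  have hterm : ∀ k ∈ Finset.range (N + 1),
      b k ≤ 1 / (2 * ((N : ℝ) + 1)) + (N * δ - k) ^ 2 * b k / (η * N) ^ 2 := by
    intro k hk
    have hk' : k ≤ N := by simpa [Nat.lt_succ_iff] using hk
    have hsq : 0 ≤ (N * δ - k) ^ 2 * b k / (η * N) ^ 2 := by have := hb0 k; positivity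
    by_cases h : |(k : ℝ) - N * δ| ≤ η * N
    · have h1 := hcon k hk' h
      have : b k ≤ 1 / (2 * ((N : ℝ) + 1)) := by
        rw [le_div_iff₀ (by positivity)]; linarith
      linarith
    · have h1 : (η * N) ^ 2 ≤ (N * δ - k) ^ 2 := by
        rw [← sq_abs (N * δ - k), abs_sub_comm]
        exact pow_le_pow_left₀ (by positivity) (not_le.1 h).le 2
      have : b k ≤ (N * δ - k) ^ 2 * b k / (η * N) ^ 2 := by
        rw [le_div_iff₀ (by positivity), mul_comm]
        exact mul_le_mul_of_nonneg_right h1 (hb0 k)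
      have : 0 ≤ 1 / (2 * ((N : ℝ) + 1)) := by positivity
      linarith
  have hall := Finset.sum_le_sum hterm
  rw [hsum, Finset.sum_add_distrib, ← Finset.sum_div (Finset.range (N + 1)) (fun k : ℕ => (N * δ - k) ^ 2 * b k), hvar] at hall
  simp only [Finset.sum_const, Finset.card_range, nsmul_eq_mul] at hall
  have e1 : ((N + 1 : ℕ) : ℝ) * (1 / (2 * ((N : ℝ) + 1))) = 1 / 2 := by
    push_cast; field_simp
  have e2 : N * δ * (1 - δ) / (η * N) ^ 2 ≤ 1 / 4 := by
    rw [div_le_iff₀ (by positivity)]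
    have h1 : 1 ≤ N * η ^ 2 := by rwa [div_le_iff₀ (by positivity)] at hN
    have h2 : δ * (1 - δ) ≤ 1 / 4 := by nlinarith [sq_nonneg (δ - 1 / 2)]
    nlinarith [mul_le_mul_of_nonneg_left h2 hN0'.le, mul_le_mul_of_nonneg_left h1 hN0'.le]
  rw [e1] at hall
  linarith

theorem eventually_log_le (L : ℝ) {c : ℝ} (hc : 0 < c) :
    ∀ᶠ n : ℕ in atTop, L + Real.log (2 * ((n : ℝ) + 1)) ≤ n * c := by
  have ht : Tendsto (fun n : ℕ => 2 * ((n : ℝ) + 1)) atTop atTop :=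
    (tendsto_natCast_atTop_atTop.atTop_add tendsto_const_nhds).const_mul_atTop two_pos
  have h := (Real.isLittleO_log_id_atTop.comp_tendsto ht).def (by positivity : 0 < c / 4)
  filter_upwards [h, tendsto_natCast_atTop_atTop.eventually_ge_atTop ((L + c / 2) * 2 / c)]
    with n hn hL
  simp only [Function.comp, id, Real.norm_eq_abs] at hn
  rw [abs_of_nonneg (by positivity : (0 : ℝ) ≤ 2 * ((n : ℝ) + 1))] at hn
  have h1 := (le_abs_self _).trans hn
  rw [div_le_iff₀ hc] at hL
  linarith

variable {q : ℕ} {ε : ℝ}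

set_option maxHeartbeats 1000000 in
/-- The exponent of the error probability is asymptotically at most a combination, with weights
`μ` and `1 - μ`, of `log (1 / ε)` and the sphere-packing exponent. -/
theorem eventually_exponent_le [NeZero q] (hq3 : 3 ≤ q) (hq : Odd q) (hε0 : 0 < ε)
    (hε : ε ≤ 1 / 2) {δ : ℝ} (hδ0 : 0 < δ) (hδ1 : δ < 1) {μ : ℝ} (hμ0 : 0 ≤ μ) (hμ1 : μ < 1)
    {R R₁ : ℝ} (hR₁ : R₁ = Real.logb 2 q - Real.binEntropy δ / Real.log 2)
    (hR₀ : Real.logb 2 (lovaszTheta (SimpleGraph.cycleGraph q)) ≤ R₁)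
    (hR : μ * Real.logb 2 (lovaszTheta (SimpleGraph.cycleGraph q)) + (1 - μ) * R₁ < R)
    {ζ : ℝ} (hζ : 0 < ζ) :
    ∀ᶠ n : ℕ in atTop, 0 < minErrorProb (typewriter q ε) ⌈(2 : ℝ) ^ ((n : ℝ) * R)⌉₊ n ∧
      1 / (n : ℝ) * Real.logb 2
        (1 / minErrorProb (typewriter q ε) ⌈(2 : ℝ) ^ ((n : ℝ) * R)⌉₊ n) ≤
        μ * Real.logb 2 (1 / ε) + (1 - μ) * binDiv δ ε + ζ := by
  have hl : 0 < Real.log 2 := Real.log_pos one_lt_two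
  have hδ' : 0 < 1 - δ := by linarith
  have hε' : 0 < 1 - ε := by linarith
  have hq0 : (0 : ℝ) < q := by exact_mod_cast (by omega : 0 < q)
  set θ := lovaszTheta (SimpleGraph.cycleGraph q) with hθ
  have hθ1 : 1 ≤ θ := by
    obtain ⟨t, ht, -⟩ := exists_orthonormalRep_cycleGraph hq3 hq
    exact one_le_lovaszTheta ⟨t, ht⟩
  have hθ0 : 0 < θ := by linarith
  have hθl : Real.log θ = Real.logb 2 θ * Real.log 2 := by
    rw [← Real.log_div_log, div_mul_cancel₀ _ hl.ne']
  have hql : Real.log q = R₁ * Real.log 2 + Real.binEntropy δ := by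
    rw [hR₁, ← Real.log_div_log]; field_simp; ring
  set R₀ := Real.logb 2 θ
  set m := δ * Real.log ε + (1 - δ) * Real.log (1 - ε) with hm
  set H := Real.binEntropy δ with hH
  have hH' : H = -(δ * Real.log δ) - (1 - δ) * Real.log (1 - δ) := by
    rw [hH, Real.binEntropy_eq_negMulLog_add_negMulLog_one_sub, Real.negMulLog, Real.negMulLog]
    ring
  have hD : binDiv δ ε * Real.log 2 = -H - m := by rw [binDiv, div_mul_cancel₀ _ hl.ne']
  have hD0 := binDiv_nonneg hε0 (by linarith) hδ0 hδ1
  set A := |Real.log δ - Real.log (1 - δ)| with hA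
  set B := |Real.log ε - Real.log (1 - ε)| with hB
  have hA0 : 0 ≤ A := abs_nonneg _
  have hB0 : 0 ≤ B := abs_nonneg _
  -- `γ` is the slack in rate and `ζ` that in exponent. `c` is half the smaller, in nats, and `η`
  -- keeps the total cost of replacing Nδ by k below c per letter.
  obtain ⟨γ, hγ⟩ : ∃ γ, γ = R - (μ * R₀ + (1 - μ) * R₁) := ⟨_, rfl⟩
  have hγ0 : 0 < γ := by linarith
  obtain ⟨c, hc⟩ : ∃ c, c = min γ ζ * Real.log 2 / 2 := ⟨_, rfl⟩
  have hc0 : 0 < c := by rw [hc]; positivity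
  have hcγ : 2 * c ≤ γ * Real.log 2 := by
    have := mul_le_mul_of_nonneg_right (min_le_left γ ζ) hl.le
    linarith
  have hcζ : 2 * c ≤ ζ * Real.log 2 := by
    have := mul_le_mul_of_nonneg_right (min_le_right γ ζ) hl.le
    linarith
  obtain ⟨η, hη⟩ : ∃ η, η = c / (A + B + 1) := ⟨_, rfl⟩
  have hη0 : 0 < η := by rw [hη]; positivity
  have hηc : η * (A + B) ≤ c := by
    have : η * (A + B + 1) = c := by rw [hη]; field_simp
    linarith
  obtain ⟨N₀, hN₀⟩ := eventually_atTop.1 (eventually_exists_choose_ge hδ0 hδ1 hη0)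
  filter_upwards [eventually_log_le (-Real.log ε + Real.log 2) hc0, eventually_gt_atTop 0,
    tendsto_natCast_atTop_atTop.eventually_ge_atTop (((N₀ : ℝ) + 1) / (1 - μ))]
    with n hlog hn0 hnN
  have hn0' : (0 : ℝ) < n := by exact_mod_cast hn0
  have h1μ : 0 < 1 - μ := by linarith
  rw [div_le_iff₀ h1μ] at hnN
  -- Rounding up favours the rate condition, since R₀ ≤ R₁, and costs the exponent at most one
  -- factor ε.
  obtain ⟨n₂, hn₂⟩ : ∃ n₂, n₂ = ⌈μ * n⌉₊ := ⟨_, rfl⟩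
  have hn₂l : μ * n ≤ n₂ := by rw [hn₂]; exact Nat.le_ceil _
  have hn₂u : (n₂ : ℝ) < μ * n + 1 := by rw [hn₂]; exact Nat.ceil_lt_add_one (by positivity)
  have hn₂n : n₂ ≤ n := by
    rw [hn₂, Nat.ceil_le]; exact mul_le_of_le_one_left hn0'.le hμ1.le
  obtain ⟨N, rfl⟩ := Nat.exists_eq_add_of_le' hn₂n
  push_cast at hlog hn₂l hn₂u hnN hn0'
  have hNN₀ : N₀ ≤ N := by
    have : (N₀ : ℝ) ≤ N := by linarith
    exact_mod_cast this
  obtain ⟨k, hkN, hk, hchoose⟩ := hN₀ N hNN₀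
  have hCpos : (0 : ℝ) < N.choose k := by exact_mod_cast Nat.choose_pos hkN
  obtain ⟨C, hC⟩ : ∃ C : ℝ, C = N.choose k := ⟨_, rfl⟩
  rw [← hC] at hchoose hCpos
  have hkN' : ((N - k : ℕ) : ℝ) = N - k := by push_cast [hkN]; ring
  have hlogC : -Real.log (2 * ((N : ℝ) + 1)) + N * H - η * N * A ≤ Real.log C := by
    have h := Real.log_le_log one_pos hchoose
    rw [Real.log_one, Real.log_mul (x := 2 * ((N : ℝ) + 1)) (by positivity) (by positivity),
      Real.log_mul (x := C * δ ^ k) (by positivity) (by positivity),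
      Real.log_mul (x := C) (by positivity) (by positivity),
      Real.log_pow, Real.log_pow, hkN'] at h
    have h1 : (k - N * δ) * (Real.log δ - Real.log (1 - δ)) ≤ η * N * A := by
      refine (le_abs_self _).trans ?_
      rw [abs_mul]
      exact mul_le_mul_of_nonneg_right hk (abs_nonneg _)
    rw [hH']
    linarith
  have hlogN : Real.log (2 * ((N : ℝ) + 1)) ≤ Real.log (2 * ((N : ℝ) + n₂ + 1)) :=
    Real.log_le_log (by positivity) (by have : (0 : ℝ) ≤ n₂ := by positivity
                                        linarith)
  have hNle : (N : ℝ) ≤ N + n₂ := by have : (0 : ℝ) ≤ n₂ := by positivity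
                                     linarith
  have hηA : η * N * A + η * N * B ≤ (N + n₂) * c := by
    calc η * N * A + η * N * B = N * (η * (A + B)) := by ring
      _ ≤ N * c := mul_le_mul_of_nonneg_left hηc (by positivity)
      _ ≤ _ := mul_le_mul_of_nonneg_right hNle hc0.le
  have hηB0 : 0 ≤ η * N * B := by positivity
  have hεl : Real.log ε ≤ 0 := Real.log_nonpos hε0.le (by linarith)
  set M := ⌈(2 : ℝ) ^ (((N + n₂ : ℕ) : ℝ) * R)⌉₊ with hM
  have hMpos : 0 < M := Nat.ceil_pos.2 (by positivity)
  have hM' : (2 : ℝ) ^ (((N : ℝ) + n₂) * R) ≤ M := by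
    have := Nat.le_ceil ((2 : ℝ) ^ (((N + n₂ : ℕ) : ℝ) * R))
    push_cast at this
    exact_mod_cast this
  -- The rate slack lets the lists absorb at most half of the noise words of weight `k`.
  have hhalf : θ ^ n₂ * q ^ N / M ≤ C / 2 := by
    have hM0 : (0 : ℝ) < M := by exact_mod_cast hMpos
    rw [← Real.log_le_log_iff (by positivity) (by positivity),
      Real.log_div (by positivity) (by positivity), Real.log_mul (by positivity) (by positivity),
      Real.log_pow, Real.log_pow, Real.log_div hCpos.ne' two_ne_zero, hθl, hql]
    have h1 := Real.log_le_log (by positivity) hM'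
    rw [Real.log_rpow two_pos] at h1
    have h2 : (n₂ : ℝ) * R₀ + N * R₁ - (N + n₂) * R ≤ -((N + n₂) * γ) := by
      have := mul_le_mul_of_nonneg_right hn₂l (sub_nonneg.2 hR₀)
      rw [hγ]; linarith
    have h3 := mul_le_mul_of_nonneg_right h2 hl.le
    have h4 := mul_le_mul_of_nonneg_left hcγ hn0'.le
    linarith
  have hlow := minErrorProb_typewriter_ge hq3 hq hε0 hε (n₁ := N) (n₂ := n₂) hMpos k
  rw [← hθ, ← hC] at hlow
  set Pe := minErrorProb (typewriter q ε) M (N + n₂)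
  have hlow' : ε ^ n₂ * (ε ^ k * (1 - ε) ^ (N - k) * (C / 2)) ≤ Pe := by
    refine le_trans ?_ hlow
    refine mul_le_mul_of_nonneg_left (mul_le_mul_of_nonneg_left ?_ (by positivity)) (by positivity)
    linarith
  have hlowpos : 0 < ε ^ n₂ * (ε ^ k * (1 - ε) ^ (N - k) * (C / 2)) := by positivity
  have hPe : 0 < Pe := hlowpos.trans_le hlow'
  refine ⟨hPe, ?_⟩
  have hlogP := Real.log_le_log hlowpos hlow'
  rw [Real.log_mul (by positivity) (by positivity), Real.log_mul (by positivity) (by positivity),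
    Real.log_mul (by positivity) (by positivity), Real.log_pow, Real.log_pow, Real.log_pow,
    Real.log_div hCpos.ne' two_ne_zero, hkN'] at hlogP
  have hB1 : -((k - N * δ) * (Real.log ε - Real.log (1 - ε))) ≤ η * N * B := by
    refine (neg_le_abs _).trans ?_
    rw [abs_mul]
    exact mul_le_mul_of_nonneg_right hk (abs_nonneg _)
  rw [one_div, inv_mul_eq_div, div_le_iff₀ (by push_cast; exact hn0'), one_div, Real.logb_inv,
    one_div, Real.logb_inv, ← Real.log_div_log, ← Real.log_div_log]
  refine le_of_mul_le_mul_right ?_ hl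
  push_cast
  have e1 : -(Real.log Pe / Real.log 2) * Real.log 2 = -Real.log Pe := by
    field_simp
  have e2 : (μ * -(Real.log ε / Real.log 2) + (1 - μ) * binDiv δ ε + ζ) * (N + n₂) * Real.log 2
      = (N + n₂) * (μ * -Real.log ε + (1 - μ) * (binDiv δ ε * Real.log 2) + ζ * Real.log 2) := by
    field_simp
  rw [e1, e2]
  have f1 : (n₂ : ℝ) * -Real.log ε ≤ (μ * (N + n₂) + 1) * -Real.log ε :=
    mul_le_mul_of_nonneg_right hn₂u.le (by linarith)
  have f2 : (N : ℝ) * (binDiv δ ε * Real.log 2) ≤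
      ((1 - μ) * (N + n₂)) * (binDiv δ ε * Real.log 2) :=
    mul_le_mul_of_nonneg_right (by linarith) (by positivity)
  have f3 := mul_le_mul_of_nonneg_left hcζ hn0'.le
  rw [hD] at f2 ⊢
  rw [hm] at f2 ⊢
  linarith

/-- `eventually_exponent_le` needs a strict rate inequality. A weight μ slightly above `lam`
provides it because log θ < R₁, and the bound is continuous in μ. -/
theorem reliability_typewriter_le [NeZero q] (hq3 : 3 ≤ q) (hq : Odd q) (hε0 : 0 < ε)
    (hε : ε ≤ 1 / 2) {δ : ℝ} (hδ0 : 0 < δ) (hδ1 : δ < 1) {lam : ℝ} (hlam0 : 0 ≤ lam)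
    (hlam1 : lam < 1) {R R₁ : ℝ} (hR₁ : R₁ = Real.logb 2 q - Real.binEntropy δ / Real.log 2)
    (hR₀ : Real.logb 2 (lovaszTheta (SimpleGraph.cycleGraph q)) < R₁)
    (hR : R = lam * Real.logb 2 (lovaszTheta (SimpleGraph.cycleGraph q)) + (1 - lam) * R₁) :
    reliability (typewriter q ε) R ≤
      ((lam * Real.logb 2 (1 / ε) + (1 - lam) * binDiv δ ε : ℝ) : EReal) := by
  refine EReal.le_of_forall_lt_iff_le.1 fun c hc => ?_
  have hc : lam * Real.logb 2 (1 / ε) + (1 - lam) * binDiv δ ε < c := by exact_mod_cast hc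
  have hcont : Continuous fun μ : ℝ => μ * Real.logb 2 (1 / ε) + (1 - μ) * binDiv δ ε := by
    fun_prop
  obtain ⟨μ, hμ, hμ'⟩ := ((hcont.continuousAt.eventually (gt_mem_nhds hc)).filter_mono
    nhdsWithin_le_nhds |>.and (Ioo_mem_nhdsGT hlam1)).exists
  refine limsup_le_of_le (by isBoundedDefault) ?_
  filter_upwards [eventually_exponent_le hq3 hq hε0 hε hδ0 hδ1 (hlam0.trans hμ'.1.le) hμ'.2 hR₁
    hR₀.le (R := R) (by
      rw [hR]
      nlinarith [mul_pos (sub_pos.2 hμ'.1) (sub_pos.2 hR₀)]) (sub_pos.2 hμ)] with n hn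
  rw [if_neg hn.1.ne']
  have := hn.2
  rw [add_sub_cancel] at this
  exact_mod_cast this

end Asymptotics

/-! ### The tangent segment bound -/

theorem logb_lovaszTheta_lt_tiltRate {q : ℕ} [NeZero q] (hq3 : 3 ≤ q) (hq : Odd q) (ε ρ : ℝ) :
    Real.logb 2 (lovaszTheta (SimpleGraph.cycleGraph q)) < tiltRate q ε ρ := by
  obtain ⟨t, ht, htq⟩ := exists_orthonormalRep_cycleGraph hq3 hq
  have h1 := one_le_lovaszTheta ⟨t, ht⟩
  refine lt_of_lt_of_le ?_ (logb_half_le_tiltRate (by omega) ρ)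
  exact Real.logb_lt_logb one_lt_two (by linarith) ((lovaszTheta_le_of_mem ht).trans_lt htq)

theorem theorem5 (q : ℕ) [NeZero q] (hq4 : 4 ≤ q) (hq : Odd q)
    (ε : ℝ) (hε0 : 0 < ε) (hε : ε ≤ 1 / 2) :
    (∃! R₁ : ℝ, IsTangentAt (spherePacking (typewriter q ε))
      (Real.logb 2 (lovaszTheta (SimpleGraph.cycleGraph q))) (Real.logb 2 (1 / ε)) R₁) ∧
    ∀ R₁ : ℝ, IsTangentAt (spherePacking (typewriter q ε))
        (Real.logb 2 (lovaszTheta (SimpleGraph.cycleGraph q))) (Real.logb 2 (1 / ε)) R₁ →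
      (ε < 1 / 2 →
        HasDerivAt (fun R : ℝ => (spherePacking (typewriter q ε) R).toReal)
          (slopeThrough (Real.logb 2 (lovaszTheta (SimpleGraph.cycleGraph q)))
            (Real.logb 2 (1 / ε)) R₁ (spherePacking (typewriter q ε) R₁).toReal) R₁) ∧
      ∀ R : ℝ, Real.logb 2 (lovaszTheta (SimpleGraph.cycleGraph q)) < R → R ≤ R₁ →
        reliability (typewriter q ε) R ≤
          ((lineThrough (Real.logb 2 (lovaszTheta (SimpleGraph.cycleGraph q)))
            (Real.logb 2 (1 / ε)) R₁ (spherePacking (typewriter q ε) R₁).toReal R : ℝ) :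
            EReal) := by
  have hε1 : ε < 1 := by linarith
  have hq3 : 3 ≤ q := by omega
  have hT := hasTangents_typewriterE0 q hε0 hε1
  have hR₀ : ∀ ρ, 0 ≤ ρ → Real.logb 2 (lovaszTheta (SimpleGraph.cycleGraph q)) < tiltRate q ε ρ :=
    fun ρ _ => logb_lovaszTheta_lt_tiltRate hq3 hq ε ρ
  have he₀ : 0 < Real.logb 2 (1 / ε) :=
    Real.logb_pos one_lt_two (by rw [lt_div_iff₀ hε0]; linarith)
  have hD0 : binDiv (tilt ε 0) ε = 0 := by rw [tilt_zero, binDiv_self]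
  have hgap : Real.logb 2 (lovaszTheta (SimpleGraph.cycleGraph q)) < Real.logb 2 (q / 2) := by
    obtain ⟨t, ht, htq⟩ := exists_orthonormalRep_cycleGraph hq3 hq
    have := one_le_lovaszTheta ⟨t, ht⟩
    exact Real.logb_lt_logb one_lt_two (by linarith) ((lovaszTheta_le_of_mem ht).trans_lt htq)
  rw [spherePacking_typewriter (by omega) hε0 hε1]
  obtain ⟨ρ, hρ, hρe⟩ := exists_intercept (continuousOn_typewriterE0 q hε0 hε1)
    (typewriterE0_zero hε0 hε1) he₀ hgap
    fun ρ hρ => mul_logb_half_le_typewriterE0 (by omega) hε0 hε1 hρ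
  have huniq : ∀ R₁, IsTangentAt (conjugate (typewriterE0 q ε))
      (Real.logb 2 (lovaszTheta (SimpleGraph.cycleGraph q))) (Real.logb 2 (1 / ε)) R₁ →
      R₁ = tiltRate q ε ρ := by
    intro R₁ hR₁
    obtain ⟨ρ', hρ', hρe', rfl⟩ := hT.eq_of_isTangentAt hD0 he₀ hR₁
    rw [hT.intercept_unique hR₀ hρ hρe hρ' hρe']
  refine ⟨⟨_, hT.isTangentAt hρ hρe (hR₀ ρ hρ.le), huniq⟩, fun R₁ hR₁ => ?_⟩
  obtain rfl := huniq R₁ hR₁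
  have hslope := hT.slopeThrough_eq hρ hρe (hR₀ ρ hρ.le)
  refine ⟨fun hlt => ?_, fun R hRl hRu => ?_⟩
  · rw [hslope]
    exact hT.hasDerivAt_conjugate (strictAntiOn_tiltRate hε0 hlt) hρ
  · rw [lineThrough, hslope]
    have hpos := sub_pos.2 (hR₀ ρ hρ.le)
    set R₀ := Real.logb 2 (lovaszTheta (SimpleGraph.cycleGraph q))
    -- The weight of `R₀` when R is written as a convex combination of `R₀` and the tangency rate.
    obtain ⟨lam, hlam⟩ : ∃ lam, lam = (tiltRate q ε ρ - R) / (tiltRate q ε ρ - R₀) := ⟨_, rfl⟩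
    have hlam' : lam * (tiltRate q ε ρ - R₀) = tiltRate q ε ρ - R := by
      rw [hlam, div_mul_cancel₀ _ hpos.ne']
    refine (reliability_typewriter_le hq3 hq hε0 hε (tilt_pos hε0 hε1 ρ) (tilt_lt_one hε0 hε1 ρ)
      (lam := lam) (by rw [hlam]; exact div_nonneg (by linarith) hpos.le)
      (by rw [hlam, div_lt_one hpos]; linarith) rfl (hR₀ ρ hρ.le) (R := R)
      (show R = lam * R₀ + (1 - lam) * tiltRate q ε ρ by linarith)).trans (le_of_eq ?_)
    congr 1
    have e1 := hT.eq ρ hρ.le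
    have e2 : Real.logb 2 (1 / ε) = ρ * (tiltRate q ε ρ - R₀) + binDiv (tilt ε ρ) ε := by linarith
    rw [e2]
    linear_combination ρ * hlam'
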